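/- **Conventions.** For $n\ge 1$ and $q=(q_1,\dots,q_n)$ put $q_0=1$ and $q_\alpha=0$ for $\alpha>n$. The potentials $V_i^{(k)}$ ($1\le i\le n$, $k\in\mathbb Z$) are the functions of $q$ determined by $V_i^{(0)}=\delta_{in}$, $V_i^{(k+1)}=V_{i+1}^{(k)}-q_iV_1^{(k)}$ and, for negative $k$, by the reversed recursion $V_i^{(k)}=V_{i-1}^{(k+1)}-\frac{q_{i-1}}{q_n}V_n^{(k+1)}$, with $V_i^{(k)}=0$ unless $1\le i\le n$. For $m,k\in\mathbb Z$ let (with $\varepsilon=-1$) $$L^{n,m,k}=\tfrac14\sum_{i,j=1}^n V_1^{(2n-m-i-j)}\,q_{i,x}q_{j,x}+\tfrac14 V_1^{(k)},\qquad E_i=\frac{\partial}{\partial q_i}-\frac{d}{dx}\frac{\partial}{\partial q_{i,x}} .$$ The Killing fields in these coordinates are $$(Z_i^n[q])^j=(q_{j+i-1})_x+\sum_{k=1}^{j-1}\bigl(q_k(q_{j+i-k-1})_x-q_{j+i-k-1}(q_k)_x\bigr).$$ **The local hierarchy.** Fix $N\ge1$. For $s\ge 0$ put $n'=s+N$. The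 $s$ equations $E_i(L^{n',n'-N,-n'})=0$, $i=1,\dots,s$, with $q_{n'}\neq0$, express $q_{n'},q_{n'-1},\dots,q_{N+1}$ as differential functions of $\bar q=(q_1,\dots,q_N)$, uniquely once the sign of $q_{n'}$ is chosen. Substituting them into the first $N$ components of $Z^{n'}_{n'-r+1}$ gives the field $\overline X_r^N[\bar q]$, $r=1,\dots,s$, and $\bar q_{\tau_r}=\overline X^N_r[\bar q]$, $r=1,\dots,s$, are the first $s$ equations of the $N$-component local (purely differential) coupled Harry Dym hierarchy, in the branch given by the chosen sign (the same for all $r$). **Theorem.** Let $n\ge1$, $N\ge1$, $\beta\in\{0,\dots,n-1\}$, and let $a_1,\dots,a_n,c_1,\dots,c_n$ be real constants. Let $\lambda_1,\dots,\lambda_n$ be continuous, pairwise distinct real functions of $(t_1,\dots,t_n)$ on a connected open set $U\subseteq\mathbb R^n$ given implicitly by $$t_i+c_i=\frac12\sum_{r=1}^n\sigma_r\int\frac{\lambda_r^{n-i}}{\sqrt{\lambda_r^{\,n-\beta-N}\Bigl(\sum_{j=1}^n a_j\lambda_r^{n-j}+\frac14\lambda_r^{\,\beta-n}\Bigr)}}\,d\lambda_r,\qquad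 i=1,\dots,n,$$ with signs $\sigma_r\in\{1,-1\}$ not depending on $i$, where $\lambda_r\neq0$ and the radicands are positive. Let $$q_j=(-1)^j\sum_{1\le s_1<\dots<s_j\le n}\lambda_{s_1}\cdots\lambda_{s_j}$$ (so $q_j=0$ for $j>n$), and $x=t_1$. Then $q_1,\dots,q_N$ are smooth on $U$ and solve there, in one of the two branches, the first $n-\beta$ equations (the first $n-1$ equations if $\beta\in\{0,1\}$) of the $N$-component local coupled Harry Dym hierarchy, with evolution times $\tau_r=t_{n-r+1}$, that is $t_{\beta+1}=\tau_{n-\beta},\dots,t_n=\tau_1$ (respectively $t_2=\tau_{n-1},\dots,t_n=\tau_1$ for $\beta\in\{0,1\}$). The remaining $t_i$ are free parameters. -/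

import Mathlib

open scoped ContDiff

noncomputable section

namespace HarryDym

/-! Points and vectors in Viète coordinates are sequences `q : ℕ → ℝ`, of which only the entries
`q 1, …, q n` matter. -/

/-- The conventions `q_0 = 1` and `q_α = 0` for `α > n`. -/
def coord (n : ℕ) (q : ℕ → ℝ) (j : ℕ) : ℝ :=
  if j = 0 then 1 else if j ≤ n then q j else 0

/-- The potentials `V_i^{(k)}`, `k ≥ 0`, from `V_i^{(k+1)} = V_{i+1}^{(k)} - q_i V_1^{(k)}` and
`V_i^{(0)} = δ_{in}`, with `V_i^{(k)} = 0` unless `1 ≤ i ≤ n`. -/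
def potentialUp (n : ℕ) (q : ℕ → ℝ) : ℕ → ℕ → ℝ
  | 0, i => if 1 ≤ i ∧ i = n then 1 else 0
  | k + 1, i =>
      if 1 ≤ i ∧ i ≤ n then
        potentialUp n q k (i + 1) - coord n q i * potentialUp n q k 1
      else 0

/-- The potentials `V_i^{(-k)}`, `k ≥ 0`, from the reversed recursion
`V_i^{(k)} = V_{i-1}^{(k+1)} - (q_{i-1} / q_n) V_n^{(k+1)}`. -/
def potentialDown (n : ℕ) (q : ℕ → ℝ) : ℕ → ℕ → ℝ
  | 0, i => if 1 ≤ i ∧ i = n then 1 else 0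
  | k + 1, i =>
      if 1 ≤ i ∧ i ≤ n then
        potentialDown n q k (i - 1) - coord n q (i - 1) / coord n q n * potentialDown n q k n
      else 0

/-- The potential `V_i^{(k)}` in dimension `n`, for any integer `k`. -/
def potential (n : ℕ) (k : ℤ) (i : ℕ) (q : ℕ → ℝ) : ℝ :=
  if 0 ≤ k then potentialUp n q k.toNat i else potentialDown n q (-k).toNat i

/-- The covariant metric `g_{ij}^{(m)} = V_1^{(2n-m-i-j)}` in Viète coordinates. -/
def metric (n : ℕ) (m : ℤ) (i j : ℕ) (q : ℕ → ℝ) : ℝ :=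
  potential n (2 * (n : ℤ) - m - i - j) 1 q

/-- The Lagrangian `L^{n,m,k} = (1/4) q_xᵀ g^{(m)} q_x - (ε/4) V_1^{(k)}` with `ε = -1`, at the
point `q` and the velocity `v = q_x`. -/
def lagrangian (n : ℕ) (m k : ℤ) (q v : ℕ → ℝ) : ℝ :=
  1 / 4 * (∑ i ∈ Finset.Icc 1 n, ∑ j ∈ Finset.Icc 1 n, metric n m i j q * v i * v j)
    - (-1) / 4 * potential n k 1 q

/-- The partial derivative of `f` in the coordinate direction `i`. -/
def pderiv {ι : Type} [DecidableEq ι] (i : ι) (f : (ι → ℝ) → ℝ) (t : ι → ℝ) : ℝ :=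
  deriv (fun y => f (Function.update t i y)) (t i)

/-- The Euler–Lagrange expression `E_i(L^{n,m,k}) = ∂L/∂q_i - d/dx ∂L/∂q_{i,x}` along the field
`w = (w_1, …, w_n)`, where `x` is one of the independent variables and the others are frozen. -/
def eulerLagrange {ι : Type} [DecidableEq ι] (x : ι) (n : ℕ) (m k : ℤ) (i : ℕ)
    (w : ℕ → (ι → ℝ) → ℝ) (t : ι → ℝ) : ℝ :=
  deriv (fun y => lagrangian n m k (Function.update (fun j => w j t) i y)
      (fun j => pderiv x (w j) t)) (w i t)
    - pderiv x (fun t' => deriv (fun y => lagrangian n m k (fun j => w j t')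
        (Function.update (fun j => pderiv x (w j) t') i y)) (pderiv x (w i) t')) t

/-- The `j`-th component of the Killing field in Viète coordinates,
`(Z_i^n[q])^j = (q_{j+i-1})_x + ∑_{k=1}^{j-1} (q_k (q_{j+i-k-1})_x - q_{j+i-k-1} (q_k)_x)`,
with `q_α = 0` for `α > n`. -/
def killing {ι : Type} [DecidableEq ι] (x : ι) (n i j : ℕ)
    (w : ℕ → (ι → ℝ) → ℝ) (t : ι → ℝ) : ℝ :=
  let q : ℕ → (ι → ℝ) → ℝ := fun α t' => coord n (fun l => w l t') α
  pderiv x (q (j + i - 1)) t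
    + ∑ k ∈ Finset.Icc 1 (j - 1),
        (q k t * pderiv x (q (j + i - k - 1)) t - q (j + i - k - 1) t * pderiv x (q k) t)

/-- The `N + s` fields `u_1, …, u_N, f_s, …, f_1`: the eliminated variables are
`q_{N+s} = f_1, q_{N+s-1} = f_2, …, q_{N+1} = f_s`. -/
def assemble {X : Type} (N s : ℕ) (u f : ℕ → X) : ℕ → X :=
  fun j => if j ≤ N then u j else f (N + s + 1 - j)

/-- The functions `f_1, …, f_s` are the eliminated variables `q_{n'} = f_1, …, q_{N+1} = f_s`,
`n' = N + s`, computed from `u = (u_1, …, u_N)`: together with `u` they solve the first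
`s = n' - N` Euler–Lagrange equations of the Lagrangian `L^{n',n'-N,-n'}`. The first of these
equations determines `q_{n'}` up to its sign only, and `η = ±1` is the chosen sign. -/
structure IsElimination {ι : Type} [Fintype ι] [DecidableEq ι] (x : ι) (N s : ℕ) (η : ℝ)
    (U : Set (ι → ℝ)) (u f : ℕ → (ι → ℝ) → ℝ) : Prop where
  smooth : ∀ a ∈ Finset.Icc 1 s, ContDiffOn ℝ ∞ (f a) U
  branch : ∀ t ∈ U, 0 < η * f 1 t
  euler : ∀ i ∈ Finset.Icc 1 s, ∀ t ∈ U,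
    eulerLagrange x (N + s) (s : ℤ) (-((N + s : ℕ) : ℤ)) i (assemble N s u f) t = 0

/-- `u = (u_1, …, u_N)` is on the open set `U` a smooth solution of the first `s` equations
`∂u/∂τ_r = X_r^N[u]`, `r = 1, …, s`, of the `N`-component local cHD hierarchy, in the branch of
sign `η`. With `n' = N + s`, the field `X_r^N[u]` consists of the first `N` components of
`Z_{n'-r+1}^{n'}` after the elimination of `q_{N+1}, …, q_{n'}`. The time `τ_r` is the variable
with index `τ p`, where `r = p + 1`. -/
def SolvesFirstFlows {ι : Type} [Fintype ι] [DecidableEq ι] (x : ι) (N s : ℕ) (τ : Fin s → ι)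
    (η : ℝ) (U : Set (ι → ℝ)) (u : ℕ → (ι → ℝ) → ℝ) : Prop :=
  (∀ j ∈ Finset.Icc 1 N, ContDiffOn ℝ ∞ (u j) U) ∧
  (∃ f, IsElimination x N s η U u f) ∧
  ∀ f, IsElimination x N s η U u f →
    ∀ p : Fin s, ∀ j ∈ Finset.Icc 1 N, ∀ t ∈ U,
      pderiv (τ p) (u j) t = killing x (N + s) (N + s - p) j (assemble N s u f) t

/-- The Viète polynomial `q_j(λ) = (-1)^j ∑_{s_1 < … < s_j} λ_{s_1} ⋯ λ_{s_j}`; it is `0` for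
`j > n`. -/
def viete {n : ℕ} (l : Fin n → ℝ) (j : ℕ) : ℝ :=
  (-1) ^ j * ∑ S ∈ Finset.powersetCard j (Finset.univ : Finset (Fin n)), ∏ r ∈ S, l r

/-- The radicand `y^{n-β-N} (∑_{j=1}^n a_j y^{n-j} + (1/4) y^{β-n})`; `a j` with `j : Fin n`
stands for `a_{j+1}`. -/
def radicand (n N β : ℕ) (a : Fin n → ℝ) (y : ℝ) : ℝ :=
  y ^ ((n : ℤ) - β - N) *
    (∑ j : Fin n, a j * y ^ (n - 1 - (j : ℕ)) + 1 / 4 * y ^ ((β : ℤ) - n))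

/-- On `U` the continuous, pairwise distinct functions `λ_r(t_1, …, t_n)` satisfy
`t_i + c_i = (1/2) ∑_r σ_r ∫ λ_r^{n-i} / √(radicand (λ_r)) dλ_r`, `i = 1, …, n`, with signs
`σ_r = ±1`. The indefinite integral in the place `(i, r)` is an antiderivative `Φ i r` of the
integrand on an open set `J r` on which the integrand makes sense. Indices in `Fin n` start
at `0`, so `i : Fin n` stands for `i + 1`. -/
def IsImplicitSolution (n N β : ℕ) (a c : Fin n → ℝ) (U : Set (Fin n → ℝ))
    (lam : Fin n → (Fin n → ℝ) → ℝ) : Prop :=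
  (∀ r, ContinuousOn (lam r) U) ∧
  (∀ t ∈ U, Function.Injective fun r => lam r t) ∧
  ∃ (σ : Fin n → ℝ) (J : Fin n → Set ℝ) (Φ : Fin n → Fin n → ℝ → ℝ),
    (∀ r, σ r = 1 ∨ σ r = -1) ∧
    (∀ r, IsOpen (J r)) ∧
    (∀ r, ∀ y ∈ J r, y ≠ 0 ∧ 0 < radicand n N β a y) ∧
    (∀ i r, ∀ y ∈ J r,
      HasDerivAt (Φ i r) (y ^ (n - 1 - (i : ℕ)) / Real.sqrt (radicand n N β a y)) y) ∧
    (∀ r, ∀ t ∈ U, lam r t ∈ J r) ∧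
    ∀ i, ∀ t ∈ U, t i + c i = 1 / 2 * ∑ r, σ r * Φ i r (lam r t)

/-- The number of flows that are solved: `n - β`, but `n - 1` for `β = 0, 1`. -/
def flowCount (n β : ℕ) : ℕ := if β ≤ 1 then n - 1 else n - β

end HarryDym

end

/-!
The eliminated variables are found explicitly: for a solution `λ_1, …, λ_n` with Viète coordinates
`q_1, …, q_n`, the variables `q_{N+s}, …, q_{N+1}` of the elimination are `q_n, …, q_{n+1-s}`.

*The elimination.* In the variable `w = 1/z` the potentials are coefficients of `1/Q(w)` and
`1/P(z)`, where `Q = ∑ q_j w^j` and `P = ∑ q_j z^{n'-j}`. Hence the Lagrangian `L^{n',s,-n'}` is a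
sum of three residues (`lagrangian_eq`), and its Euler–Lagrange equations of index `1, …, s` say
together (`eulerLagrange_eq_zero_iff`) that

  `1 + B P² + z^N (2 P P_xx - P_x²) = 0  (mod z^s)`,

where the polynomial `B` of degree less than `N` is the relevant part of `Q_x²/Q² - 2 Q_xx/Q` and
only depends on `q_1, …, q_N`. The coefficient of `z^k` determines the `k`-th coefficient of `P`
from the earlier ones, up to the sign of `P(0)`; this is `elimination_unique`.

*The roots.* By the inverse function theorem the `λ_r` are smooth (`contDiffOn_lam`).
Differentiating the implicit relations gives a Vandermonde system; testing it against
`p(z)/(z - λ_r)`, where `p = ∏ (z - λ_r)`, gives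
`p'(λ_r) ∂λ_r/∂t_k = 2 σ_r √(radicand) ρ_k(λ_r)` with the Horner sums
`ρ_k(λ) = ∑_{j<k} q_j λ^{k-1-j}` (`exists_pderiv_lam`).

*Existence.* By these equations for `x = t_1`, the polynomial
`1 + 4 z^{n-β} a(z) + z^N (2 p p_xx - p_x²)`, `a(z) = ∑ a_j z^{n-j}`, has a double zero at every
`λ_r`, so it is `-B p²` for a polynomial `B`, and a comparison at infinity identifies `B` with the
polynomial above (`one_add_drift_mul`). As `s ≤ n - β`, the term `4 z^{n-β} a(z)` disappears
modulo `z^s`, and `P = p` solves the elimination (`isElimination_viete`).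

*The flows.* Since `∂q_j/∂λ_r = -ρ_j(λ_r)`, one has
`∂q_j/∂t_k = -∑_r ρ_j(λ_r) ρ_k(λ_r) λ_{r,x}`, and the identity
`ρ_k ρ_j = ∑_{m<j} (q_m ρ_{j+k-1-m} - q_{j+k-1-m} ρ_m)` (`horner_mul_horner`) turns this into
the Killing field `Z_k^n` (`pderiv_viete_eq_sum`). Its first `N` components agree with those of
`Z_{k+n'-n}^{n'}` on the eliminated variables (`killing_assemble_viete`).
-/

noncomputable section

namespace HarryDym

open PowerSeries Filter Topology

/-! ### Potentials as coefficients of reciprocal series -/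

/-- The series `Q(w) = ∑_{j ≤ n} q_j w^j`. -/
def lowSeries (n : ℕ) (q : ℕ → ℝ) : ℝ⟦X⟧ := mk fun j => coord n q j

/-- The series `P(z) = ∑_{j ≤ n} q_j z^{n-j}`. -/
def highSeries (n : ℕ) (q : ℕ → ℝ) : ℝ⟦X⟧ := mk fun j => if j ≤ n then coord n q (n - j) else 0

/-- The tangent vector `∑_{1 ≤ j ≤ n} v_j w^j` of `lowSeries` in the direction `v`. -/
def lowTangent (n : ℕ) (v : ℕ → ℝ) : ℝ⟦X⟧ := mk fun j => if 1 ≤ j ∧ j ≤ n then v j else 0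

/-- The tangent vector `∑_{1 ≤ j ≤ n} v_j z^{n-j}` of `highSeries` in the direction `v`. -/
def highTangent (n : ℕ) (v : ℕ → ℝ) : ℝ⟦X⟧ := mk fun j => if j < n then v (n - j) else 0

lemma coord_zero (n : ℕ) (q : ℕ → ℝ) : coord n q 0 = 1 := by simp [coord]

lemma coord_of_lt {n j : ℕ} (h : n < j) (q : ℕ → ℝ) : coord n q j = 0 := by
  have h0 : j ≠ 0 := by omega
  simp [coord, h0, not_le.mpr h]

lemma constantCoeff_lowSeries (n : ℕ) (q : ℕ → ℝ) : constantCoeff (lowSeries n q) = 1 := by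
  rw [← coeff_zero_eq_constantCoeff_apply, lowSeries, coeff_mk, coord_zero]

lemma constantCoeff_highSeries (n : ℕ) (q : ℕ → ℝ) :
    constantCoeff (highSeries n q) = coord n q n := by
  rw [← coeff_zero_eq_constantCoeff_apply, highSeries, coeff_mk]; simp

lemma lowSeries_mul_inv (n : ℕ) (q : ℕ → ℝ) : lowSeries n q * (lowSeries n q)⁻¹ = 1 :=
  PowerSeries.mul_inv_cancel _ (by simp [constantCoeff_lowSeries])

lemma highSeries_mul_inv {n : ℕ} {q : ℕ → ℝ} (h : coord n q n ≠ 0) :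
    highSeries n q * (highSeries n q)⁻¹ = 1 :=
  PowerSeries.mul_inv_cancel _ (by rwa [constantCoeff_highSeries])

lemma coe_trunc_succ (i : ℕ) (F : ℝ⟦X⟧) :
    ((trunc (i + 1) F : Polynomial ℝ) : ℝ⟦X⟧) = ((trunc i F : Polynomial ℝ) : ℝ⟦X⟧)
      + C (coeff i F) * X ^ i := by
  rw [trunc_succ, Polynomial.coe_add, Polynomial.coe_monomial, monomial_eq_C_mul_X_pow]

/-- `V_i^{(k)}` is the coefficient of `w^{k+i}` in `w^n (q_0 + ⋯ + q_{i-1} w^{i-1}) / Q(w)`: this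
is the remainder of `z^k` modulo `∑ q_j z^{n-j}`, in the variable `w = 1/z`. -/
lemma potentialUp_eq {n : ℕ} (q : ℕ → ℝ) (k : ℕ) : ∀ i, 1 ≤ i → i ≤ n →
    potentialUp n q k i = coeff (k + i)
      (X ^ n * ((trunc i (lowSeries n q) : Polynomial ℝ) : ℝ⟦X⟧) * (lowSeries n q)⁻¹) := by
  have h1 : ∀ m, coeff m (X ^ n * ((trunc 1 (lowSeries n q) : Polynomial ℝ) : ℝ⟦X⟧)
      * (lowSeries n q)⁻¹) = coeff m (X ^ n * (lowSeries n q)⁻¹) := by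
    intro m
    have : ((trunc 1 (lowSeries n q) : Polynomial ℝ) : ℝ⟦X⟧) = 1 := by
      simp [constantCoeff_lowSeries]
    rw [this, mul_one]
  induction k with
  | zero =>
    intro i hi hin
    rw [mul_assoc, coeff_X_pow_mul']
    rcases hin.lt_or_eq with h | rfl
    · simp [potentialUp, h.ne, not_le.mpr h]
    · have : constantCoeff ((trunc i (lowSeries i q) : Polynomial ℝ) : ℝ⟦X⟧) = 1 := by
        rw [← coeff_zero_eq_constantCoeff_apply, Polynomial.coeff_coe, coeff_trunc]
        simp [constantCoeff_lowSeries, show 0 < i by omega]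
      simp [potentialUp, hi, this, constantCoeff_lowSeries]
  | succ k ih =>
    intro i hi hin
    have hs : potentialUp n q k (i + 1) = coeff (k + (i + 1))
        (X ^ n * ((trunc (i + 1) (lowSeries n q) : Polynomial ℝ) : ℝ⟦X⟧) * (lowSeries n q)⁻¹) := by
      rcases hin.lt_or_eq with h | rfl
      · exact ih _ (by omega) h
      · have h0 : potentialUp i q k (i + 1) = 0 := by
          cases k <;> simp [potentialUp]
        have : ((trunc (i + 1) (lowSeries i q) : Polynomial ℝ) : ℝ⟦X⟧) = lowSeries i q := by
          ext m
          rw [Polynomial.coeff_coe, coeff_trunc]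
          split_ifs with h
          · rfl
          · rw [lowSeries, coeff_mk, coord_of_lt (by omega)]
        rw [h0, this, mul_assoc, lowSeries_mul_inv, mul_one, coeff_X_pow, if_neg (by omega)]
    rw [potentialUp, if_pos ⟨hi, hin⟩, hs, ih 1 le_rfl (by omega), coe_trunc_succ, h1]
    have e : X ^ n * (((trunc i (lowSeries n q) : Polynomial ℝ) : ℝ⟦X⟧)
          + C (coeff i (lowSeries n q)) * X ^ i) * (lowSeries n q)⁻¹
        = X ^ n * ((trunc i (lowSeries n q) : Polynomial ℝ) : ℝ⟦X⟧) * (lowSeries n q)⁻¹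
          + C (coeff i (lowSeries n q)) * (X ^ i * (X ^ n * (lowSeries n q)⁻¹)) := by ring
    rw [e, map_add, coeff_C_mul, show k + (i + 1) = (k + 1) + i by ring, coeff_X_pow_mul,
      lowSeries, coeff_mk]
    ring

/-- `V_i^{(-k)}` is the coefficient of `z^{k+n-i}` in `(q_n + ⋯ + q_i z^{n-i}) / P(z)`. -/
lemma potentialDown_eq {n : ℕ} {q : ℕ → ℝ} (hq : coord n q n ≠ 0) (k : ℕ) :
    ∀ i, 1 ≤ i → i ≤ n → potentialDown n q k i = coeff (k + (n - i))
      (((trunc (n + 1 - i) (highSeries n q) : Polynomial ℝ) : ℝ⟦X⟧) * (highSeries n q)⁻¹) := by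
  have hPi := highSeries_mul_inv hq
  induction k with
  | zero =>
    intro i hi hin
    have hlt : n - i < n + 1 - i := by omega
    rw [zero_add, coeff_mul_eq_coeff_trunc_mul_trunc _ _ hlt, trunc_trunc,
      ← coeff_mul_eq_coeff_trunc_mul_trunc _ _ hlt, hPi, coeff_one]
    simp only [potentialDown, hi, true_and]
    exact if_congr (by omega) rfl rfl
  | succ k ih =>
    intro i hi hin
    have hn : potentialDown n q k n = coord n q n * coeff k (highSeries n q)⁻¹ := by
      have : n + 1 - n = 0 + 1 := by omega
      rw [ih n (by omega) le_rfl, this, coe_trunc_succ]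
      simp [constantCoeff_highSeries]
    have hs : potentialDown n q k (i - 1) = coeff (k + 1 + (n - i))
        (((trunc (n + 1 - i + 1) (highSeries n q) : Polynomial ℝ) : ℝ⟦X⟧)
          * (highSeries n q)⁻¹) := by
      rcases hi.lt_or_eq with h | rfl
      · rw [ih _ (by omega) (by omega), show n + 1 - (i - 1) = n + 1 - i + 1 by omega,
          show k + (n - (i - 1)) = k + 1 + (n - i) by omega]
      · have h0 : potentialDown n q k 0 = 0 := by
          cases k <;> simp [potentialDown]
        have : ((trunc (n + 1 - 1 + 1) (highSeries n q) : Polynomial ℝ) : ℝ⟦X⟧)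
            = highSeries n q := by
          ext m
          rw [Polynomial.coeff_coe, coeff_trunc]
          split_ifs with h
          · rfl
          · rw [highSeries, coeff_mk, if_neg (by omega)]
        rw [this, hPi, coeff_one, if_neg (by omega), Nat.sub_self, h0]
    rw [potentialDown, if_pos ⟨hi, hin⟩, hs, hn, coe_trunc_succ, add_mul, map_add]
    have e : C (coeff (n + 1 - i) (highSeries n q)) * X ^ (n + 1 - i) * (highSeries n q)⁻¹
        = C (coeff (n + 1 - i) (highSeries n q)) * (X ^ (n + 1 - i) * (highSeries n q)⁻¹) := by
      ring
    rw [e, coeff_C_mul, show k + 1 + (n - i) = k + (n + 1 - i) by omega, coeff_X_pow_mul,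
      highSeries, coeff_mk, if_pos (by omega), show n - (n + 1 - i) = i - 1 by omega]
    field_simp
    ring

lemma potential_one_of_nonneg {n : ℕ} (hn : 1 ≤ n) (q : ℕ → ℝ) (k : ℕ) :
    potential n k 1 q = coeff (k + 1) (X ^ n * (lowSeries n q)⁻¹) := by
  have : ((trunc 1 (lowSeries n q) : Polynomial ℝ) : ℝ⟦X⟧) = 1 := by
    simp [constantCoeff_lowSeries]
  rw [potential, if_pos (by positivity), Int.toNat_natCast, potentialUp_eq q k 1 le_rfl hn, this,
    mul_one]

lemma potential_one_of_neg {n : ℕ} (hn : 1 ≤ n) {q : ℕ → ℝ} (hq : coord n q n ≠ 0) (k : ℕ) :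
    potential n (-((k + 1 : ℕ) : ℤ)) 1 q = -coeff k (highSeries n q)⁻¹ := by
  have hT : ((trunc (n + 1 - 1) (highSeries n q) : Polynomial ℝ) : ℝ⟦X⟧)
      = highSeries n q - X ^ n := by
    have h1 : ((trunc (n + 1) (highSeries n q) : Polynomial ℝ) : ℝ⟦X⟧) = highSeries n q := by
      ext m
      rw [Polynomial.coeff_coe, coeff_trunc]
      split_ifs with h
      · rfl
      · rw [highSeries, coeff_mk, if_neg (by omega)]
    have h2 : coeff n (highSeries n q) = 1 := by simp [highSeries, coord_zero]
    have h3 := coe_trunc_succ n (highSeries n q)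
    rw [h1, h2, map_one, one_mul] at h3
    rw [Nat.add_sub_cancel]
    exact eq_sub_of_add_eq h3.symm
  rw [potential, if_neg (by push_cast; omega), neg_neg, Int.toNat_natCast,
    potentialDown_eq hq _ 1 le_rfl hn, hT, sub_mul, highSeries_mul_inv hq, map_sub, coeff_one,
    if_neg (by omega), show k + 1 + (n - 1) = k + n by omega, coeff_X_pow_mul, zero_sub]

lemma lowTangent_eq_sum (n : ℕ) (v : ℕ → ℝ) :
    lowTangent n v = ∑ i ∈ Finset.Icc 1 n, C (v i) * X ^ i := by
  ext k
  simp [lowTangent, map_sum, coeff_X_pow, Finset.sum_ite_eq]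

lemma highTangent_eq_sum (n : ℕ) (v : ℕ → ℝ) :
    highTangent n v = ∑ i ∈ Finset.Icc 1 n, C (v i) * X ^ (n - i) := by
  ext k
  simp only [highTangent, coeff_mk, map_sum, coeff_C_mul, coeff_X_pow, mul_ite, mul_one, mul_zero]
  split_ifs with h
  · rw [Finset.sum_eq_single (n - k)]
    · rw [if_pos (by omega)]
    · intro b hb hne
      rw [Finset.mem_Icc] at hb
      rw [if_neg (by omega)]
    · intro hb
      exact absurd (Finset.mem_Icc.mpr (by omega)) hb
  · refine (Finset.sum_eq_zero fun b hb => ?_).symm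
    rw [Finset.mem_Icc] at hb
    rw [if_neg (by omega)]

/-- The Lagrangian `L^{n',s,-n'}`, `n' = N + s`, as a sum of three residues: with
`Q_x = lowTangent`, `P_x = highTangent` it is a quarter of
`[w^{N+1}] Q_x²/Q - [z^{s-1}] P_x²/P - [z^{n'-1}] 1/P`. -/
lemma lagrangian_eq {N s : ℕ} (hs : 1 ≤ s) {q : ℕ → ℝ} (v : ℕ → ℝ)
    (hq : coord (N + s) q (N + s) ≠ 0) :
    lagrangian (N + s) s (-((N + s : ℕ) : ℤ)) q v
      = 1 / 4 * (coeff (N + 1) (lowTangent (N + s) v ^ 2 * (lowSeries (N + s) q)⁻¹)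
        - coeff (s - 1) (highTangent (N + s) v ^ 2 * (highSeries (N + s) q)⁻¹)
        - coeff (N + s - 1) (highSeries (N + s) q)⁻¹) := by
  have hpot : potential (N + s) (-((N + s : ℕ) : ℤ)) 1 q
      = -coeff (N + s - 1) (highSeries (N + s) q)⁻¹ := by
    have := potential_one_of_neg (by omega) hq (N + s - 1)
    rwa [show N + s - 1 + 1 = N + s by omega] at this
  have hkin : ∑ i ∈ Finset.Icc 1 (N + s), ∑ j ∈ Finset.Icc 1 (N + s),
        metric (N + s) s i j q * v i * v j
      = coeff (N + 1) (lowTangent (N + s) v ^ 2 * (lowSeries (N + s) q)⁻¹)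
        - coeff (s - 1) (highTangent (N + s) v ^ 2 * (highSeries (N + s) q)⁻¹) := by
    rw [lowTangent_eq_sum, highTangent_eq_sum, sq, sq, Finset.sum_mul_sum, Finset.sum_mul_sum,
      Finset.sum_mul, Finset.sum_mul, map_sum, map_sum, ← Finset.sum_sub_distrib]
    refine Finset.sum_congr rfl fun i hi => ?_
    rw [Finset.sum_mul, Finset.sum_mul, map_sum, map_sum, ← Finset.sum_sub_distrib]
    refine Finset.sum_congr rfl fun j hj => ?_
    rw [Finset.mem_Icc] at hi hj
    have e1 : C (v i) * X ^ i * (C (v j) * X ^ j) * (lowSeries (N + s) q)⁻¹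
        = C (v i * v j) * (X ^ (i + j) * (lowSeries (N + s) q)⁻¹) := by
      rw [map_mul, pow_add]; ring
    have e2 : C (v i) * X ^ (N + s - i) * (C (v j) * X ^ (N + s - j)) * (highSeries (N + s) q)⁻¹
        = C (v i * v j) * (X ^ (N + s - i + (N + s - j)) * (highSeries (N + s) q)⁻¹) := by
      rw [map_mul, pow_add]; ring
    rw [e1, e2, coeff_C_mul, coeff_C_mul, coeff_X_pow_mul', coeff_X_pow_mul', metric]
    by_cases h : i + j ≤ N + s + N
    · have : 2 * ((N + s : ℕ) : ℤ) - s - i - j = ((N + s + N - (i + j) : ℕ) : ℤ) := by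
        push_cast [Nat.cast_sub h]; ring
      rw [this, potential_one_of_nonneg (by omega), coeff_X_pow_mul',
        if_neg (show ¬ N + s - i + (N + s - j) ≤ s - 1 by omega)]
      by_cases h' : i + j ≤ N + 1
      · rw [if_pos h', if_pos (by omega),
          show N + s + N - (i + j) + 1 - (N + s) = N + 1 - (i + j) by omega]
        ring
      · rw [if_neg h', if_neg (by omega)]; ring
    · have : 2 * ((N + s : ℕ) : ℤ) - s - i - j
          = -((i + j - (N + s + N) - 1 + 1 : ℕ) : ℤ) := by
        rw [Nat.sub_add_cancel (by omega), Nat.cast_sub (by omega)]; push_cast; ring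
      rw [this, potential_one_of_neg (by omega) hq, if_neg (by omega), if_pos (by omega),
        show s - 1 - (N + s - i + (N + s - j)) = i + j - (N + s + N) - 1 by omega]
      ring
  rw [lagrangian, hkin, hpot]
  ring

/-! ### Differentiating power series coefficientwise -/

/-- `F'` is the derivative at `y` of the one-parameter family `F` of power series, coefficient by
coefficient. -/
def HasCoeffDerivAt (F : ℝ → ℝ⟦X⟧) (F' : ℝ⟦X⟧) (y : ℝ) : Prop :=
  ∀ k, HasDerivAt (fun z => coeff k (F z)) (coeff k F') y

namespace HasCoeffDerivAt

variable {F G : ℝ → ℝ⟦X⟧} {F' G' : ℝ⟦X⟧} {y : ℝ}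

lemma const (F₀ : ℝ⟦X⟧) (y : ℝ) : HasCoeffDerivAt (fun _ => F₀) 0 y := fun k => by
  simpa using hasDerivAt_const y (coeff k F₀)

lemma mul (hF : HasCoeffDerivAt F F' y) (hG : HasCoeffDerivAt G G' y) :
    HasCoeffDerivAt (fun z => F z * G z) (F' * G y + F y * G') y := fun k => by
  simp only [coeff_mul, map_add, ← Finset.sum_add_distrib]
  exact HasDerivAt.fun_sum fun p _ => (hF p.1).mul (hG p.2)

lemma congr_deriv (hF : HasCoeffDerivAt F F' y) (h : F' = G') : HasCoeffDerivAt F G' y := h ▸ hF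

lemma pow_two (hF : HasCoeffDerivAt F F' y) :
    HasCoeffDerivAt (fun z => F z ^ 2) (2 * F y * F') y := by
  simp only [sq]
  exact (hF.mul hF).congr_deriv (by ring)

/-- The coefficients of the reciprocal series are differentiable because each is obtained from
the earlier ones by arithmetic; the derivative is then read off from `F * F⁻¹ = 1`. -/
lemma inv (hF : HasCoeffDerivAt F F' y) (h0 : constantCoeff (F y) ≠ 0) :
    HasCoeffDerivAt (fun z => (F z)⁻¹) (-(F' * (F y)⁻¹ ^ 2)) y := by
  have hF0 : HasDerivAt (fun z => constantCoeff (F z)) (constantCoeff F') y := by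
    simpa using hF 0
  have hdiff : ∀ k, DifferentiableAt ℝ (fun z => coeff k (F z)⁻¹) y := by
    intro k
    induction k using Nat.strong_induction_on with
    | _ k ih =>
      rw [funext fun z => PowerSeries.coeff_inv k (F z)]
      split_ifs with hk
      · exact (hF0.inv h0).differentiableAt
      · refine DifferentiableAt.mul (hF0.inv h0).differentiableAt.neg
          (DifferentiableAt.fun_sum fun p _ => ?_)
        split_ifs with hp
        · exact (hF p.1).differentiableAt.mul (ih _ hp)
        · exact differentiableAt_const _
  have hI : HasCoeffDerivAt (fun z => (F z)⁻¹) (mk fun k => deriv (fun z => coeff k (F z)⁻¹) y) y :=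
    fun k => by rw [coeff_mk]; exact (hdiff k).hasDerivAt
  have hne : ∀ᶠ z in 𝓝 y, constantCoeff (F z) ≠ 0 := hF0.continuousAt.eventually_ne h0
  have hprod : F' * (F y)⁻¹ + F y * (mk fun k => deriv (fun z => coeff k (F z)⁻¹) y) = 0 := by
    ext k
    refine ((hF.mul hI) k).unique (((const (1 : ℝ⟦X⟧) y) k).congr_of_eventuallyEq ?_)
    filter_upwards [hne] with z hz
    rw [PowerSeries.mul_inv_cancel _ hz]
  have hc := PowerSeries.mul_inv_cancel _ h0
  refine hI.congr_deriv ?_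
  linear_combination (F y)⁻¹ * hprod - (mk fun k => deriv (fun z => coeff k (F z)⁻¹) y) * hc

end HasCoeffDerivAt

lemma hasCoeffDerivAt_lowSeries_update {n i : ℕ} (hi : 1 ≤ i) (hin : i ≤ n) (q : ℕ → ℝ) (y : ℝ) :
    HasCoeffDerivAt (fun z => lowSeries n (Function.update q i z)) (X ^ i) y := fun k => by
  simp only [lowSeries, coeff_mk, coord, coeff_X_pow]
  by_cases hk : k = i
  · subst hk
    simpa [show k ≠ 0 by omega, hin] using hasDerivAt_id' y
  · simpa [hk] using hasDerivAt_const y _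

lemma hasCoeffDerivAt_highSeries_update {n i : ℕ} (hi : 1 ≤ i) (hin : i ≤ n) (q : ℕ → ℝ)
    (y : ℝ) :
    HasCoeffDerivAt (fun z => highSeries n (Function.update q i z)) (X ^ (n - i)) y := fun k => by
  simp only [highSeries, coeff_mk, coord, coeff_X_pow]
  by_cases hk : k = n - i
  · subst hk
    simpa [show n - (n - i) = i by omega, show i ≠ 0 by omega, hin] using hasDerivAt_id' y
  · by_cases hkn : k ≤ n
    · simpa [hk, hkn, show n - k ≠ i by omega] using hasDerivAt_const y _
    · simpa [hk, hkn] using hasDerivAt_const y (0 : ℝ)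

lemma hasCoeffDerivAt_lowTangent_update {n i : ℕ} (hi : 1 ≤ i) (hin : i ≤ n) (v : ℕ → ℝ) (y : ℝ) :
    HasCoeffDerivAt (fun z => lowTangent n (Function.update v i z)) (X ^ i) y := fun k => by
  simp only [lowTangent, coeff_mk, coeff_X_pow]
  by_cases hk : k = i
  · subst hk
    simpa [hi, hin] using hasDerivAt_id' y
  · simpa [hk] using hasDerivAt_const y _

lemma hasCoeffDerivAt_highTangent_update {n i : ℕ} (hi : 1 ≤ i) (hin : i ≤ n) (v : ℕ → ℝ)
    (y : ℝ) :
    HasCoeffDerivAt (fun z => highTangent n (Function.update v i z)) (X ^ (n - i)) y := fun k => by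
  simp only [highTangent, coeff_mk, coeff_X_pow]
  by_cases hk : k = n - i
  · subst hk
    simpa [show n - (n - i) = i by omega, show n - i < n by omega] using hasDerivAt_id' y
  · by_cases hkn : k < n
    · simpa [hk, hkn, show n - k ≠ i by omega] using hasDerivAt_const y _
    · simpa [hk, hkn] using hasDerivAt_const y (0 : ℝ)

/-! ### The Euler–Lagrange expressions -/

lemma hasDerivAt_lagrangian_position {N s i : ℕ} (hs : 1 ≤ s) (hi : 1 ≤ i) (hin : i ≤ N + s)
    {q : ℕ → ℝ} (v : ℕ → ℝ) (hq : coord (N + s) q (N + s) ≠ 0) :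
    HasDerivAt (fun y => lagrangian (N + s) s (-((N + s : ℕ) : ℤ)) (Function.update q i y) v)
      (1 / 4 * (-coeff (N + 1) (X ^ i * (lowTangent (N + s) v * (lowSeries (N + s) q)⁻¹) ^ 2)
        + coeff (s - 1) (X ^ (N + s - i)
            * (highTangent (N + s) v * (highSeries (N + s) q)⁻¹) ^ 2)
        + coeff (N + s - 1) (X ^ (N + s - i) * (highSeries (N + s) q)⁻¹ ^ 2))) (q i) := by
  have hQ := hasCoeffDerivAt_lowSeries_update hi hin q (q i)
  have hP := hasCoeffDerivAt_highSeries_update hi hin q (q i)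
  have hP0 : constantCoeff (highSeries (N + s) (Function.update q i (q i))) ≠ 0 := by
    rwa [Function.update_eq_self, constantCoeff_highSeries]
  have hQi := hQ.inv (by rw [constantCoeff_lowSeries]; exact one_ne_zero)
  have hPi := hP.inv hP0
  have h1 := ((HasCoeffDerivAt.const (lowTangent (N + s) v ^ 2) (q i)).mul hQi) (N + 1)
  have h2 := ((HasCoeffDerivAt.const (highTangent (N + s) v ^ 2) (q i)).mul hPi) (s - 1)
  have h3 := hPi (N + s - 1)
  have hne : ∀ᶠ y in 𝓝 (q i), coord (N + s) (Function.update q i y) (N + s) ≠ 0 := by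
    have := (hP 0).continuousAt.eventually_ne (by simpa using hP0)
    filter_upwards [this] with y hy
    rwa [coeff_zero_eq_constantCoeff_apply, constantCoeff_highSeries] at hy
  refine ((((h1.sub h2).sub h3).const_mul (1 / 4)).congr_of_eventuallyEq ?_).congr_deriv ?_
  · filter_upwards [hne] with y hy
    rw [lagrangian_eq hs v hy]
    rfl
  · rw [Function.update_eq_self]
    simp only [zero_mul, zero_add, map_neg, mul_neg, sub_neg_eq_add]
    ring_nf

lemma hasDerivAt_lagrangian_velocity {N s i : ℕ} (hs : 1 ≤ s) (hi : 1 ≤ i) (hin : i ≤ N + s)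
    {q : ℕ → ℝ} (v : ℕ → ℝ) (hq : coord (N + s) q (N + s) ≠ 0) :
    HasDerivAt (fun y => lagrangian (N + s) s (-((N + s : ℕ) : ℤ)) q (Function.update v i y))
      (1 / 2 * (coeff (N + 1) (X ^ i * (lowTangent (N + s) v * (lowSeries (N + s) q)⁻¹))
        - coeff (s - 1) (X ^ (N + s - i)
            * (highTangent (N + s) v * (highSeries (N + s) q)⁻¹)))) (v i) := by
  have hQ := hasCoeffDerivAt_lowTangent_update hi hin v (v i)
  have hP := hasCoeffDerivAt_highTangent_update hi hin v (v i)
  have h1 := (hQ.pow_two.mul (HasCoeffDerivAt.const (lowSeries (N + s) q)⁻¹ (v i))) (N + 1)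
  have h2 := (hP.pow_two.mul (HasCoeffDerivAt.const (highSeries (N + s) q)⁻¹ (v i))) (s - 1)
  refine ((((h1.sub h2).sub_const (coeff (N + s - 1) (highSeries (N + s) q)⁻¹)).const_mul
    (1 / 4)).congr_of_eventuallyEq ?_).congr_deriv ?_
  · exact Eventually.of_forall fun y => lagrangian_eq hs _ hq
  · rw [Function.update_eq_self]
    have e1 : (2 : ℝ⟦X⟧) * lowTangent (N + s) v * X ^ i * (lowSeries (N + s) q)⁻¹
          + lowTangent (N + s) v ^ 2 * 0
        = C (2 : ℝ) * (X ^ i * (lowTangent (N + s) v * (lowSeries (N + s) q)⁻¹)) := by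
      rw [map_ofNat]; ring
    have e2 : (2 : ℝ⟦X⟧) * highTangent (N + s) v * X ^ (N + s - i) * (highSeries (N + s) q)⁻¹
          + highTangent (N + s) v ^ 2 * 0
        = C (2 : ℝ) * (X ^ (N + s - i)
          * (highTangent (N + s) v * (highSeries (N + s) q)⁻¹)) := by
      rw [map_ofNat]; ring
    rw [e1, e2, coeff_C_mul, coeff_C_mul]
    ring

/-! ### Partial derivatives of smooth fields -/

lemma hasDerivAt_fderiv_single {ι : Type} [Fintype ι] [DecidableEq ι] {f : (ι → ℝ) → ℝ}
    {t : ι → ℝ} (hf : DifferentiableAt ℝ f t) (i : ι) :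
    HasDerivAt (fun y => f (Function.update t i y)) (fderiv ℝ f t (Pi.single i 1)) (t i) := by
  have h2 : HasFDerivAt f (fderiv ℝ f t) (Function.update t i (t i)) := by
    rw [Function.update_eq_self]; exact hf.hasFDerivAt
  exact h2.comp_hasDerivAt (t i) (hasDerivAt_update t i (t i))

lemma hasDerivAt_pderiv {ι : Type} [Fintype ι] [DecidableEq ι] {f : (ι → ℝ) → ℝ} {t : ι → ℝ}
    (hf : DifferentiableAt ℝ f t) (i : ι) :
    HasDerivAt (fun y => f (Function.update t i y)) (pderiv i f t) (t i) :=
  (hasDerivAt_fderiv_single hf i).differentiableAt.hasDerivAt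

lemma eventually_update_mem {ι : Type} [Fintype ι] [DecidableEq ι] {U : Set (ι → ℝ)}
    (hU : IsOpen U) {t : ι → ℝ} (ht : t ∈ U) (i : ι) :
    ∀ᶠ y in 𝓝 (t i), Function.update t i y ∈ U := by
  have : ContinuousAt (fun y => Function.update t i y) (t i) :=
    (hasDerivAt_update t i (t i)).continuousAt
  exact this.eventually_mem (by rw [Function.update_eq_self]; exact hU.mem_nhds ht)

lemma pderiv_congr {ι : Type} [Fintype ι] [DecidableEq ι] {U : Set (ι → ℝ)} (hU : IsOpen U)
    {f g : (ι → ℝ) → ℝ} (h : Set.EqOn f g U) {t : ι → ℝ} (ht : t ∈ U) (i : ι) :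
    pderiv i f t = pderiv i g t := by
  refine Filter.EventuallyEq.deriv_eq ?_
  filter_upwards [eventually_update_mem hU ht i] with y hy using h hy

lemma differentiableAt_of_contDiffOn {ι : Type} [Fintype ι] {U : Set (ι → ℝ)} (hU : IsOpen U)
    {f : (ι → ℝ) → ℝ} (hf : ContDiffOn ℝ ∞ f U) {t : ι → ℝ} (ht : t ∈ U) :
    DifferentiableAt ℝ f t :=
  (hf.contDiffAt (hU.mem_nhds ht)).differentiableAt (by simp)

lemma contDiffOn_pderiv {ι : Type} [Fintype ι] [DecidableEq ι] {U : Set (ι → ℝ)} (hU : IsOpen U)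
    {f : (ι → ℝ) → ℝ} (hf : ContDiffOn ℝ ∞ f U) (i : ι) : ContDiffOn ℝ ∞ (pderiv i f) U := by
  have h1 : ContDiffOn ℝ ∞ (fun t => fderiv ℝ f t (Pi.single i 1)) U :=
    (hf.fderiv_of_isOpen hU (m := ∞) (by simp)).clm_apply contDiffOn_const
  exact h1.congr fun t ht =>
    (hasDerivAt_fderiv_single (differentiableAt_of_contDiffOn hU hf ht) i).deriv

lemma hasCoeffDerivAt_lowSeries {ι : Type} [Fintype ι] [DecidableEq ι] {n : ℕ} (x : ι)
    {w : ℕ → (ι → ℝ) → ℝ} {t : ι → ℝ} (hw : ∀ j ∈ Finset.Icc 1 n, DifferentiableAt ℝ (w j) t) :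
    HasCoeffDerivAt (fun y => lowSeries n fun j => w j (Function.update t x y))
      (lowTangent n fun j => pderiv x (w j) t) (t x) := fun k => by
  simp only [lowSeries, lowTangent, coeff_mk, coord]
  rcases Nat.eq_zero_or_pos k with rfl | hk
  · simpa using hasDerivAt_const _ _
  · by_cases hkn : k ≤ n
    · simpa [hk.ne', hkn, Nat.one_le_iff_ne_zero] using
        hasDerivAt_pderiv (hw k (Finset.mem_Icc.mpr ⟨hk, hkn⟩)) x
    · simpa [hk.ne', hkn] using hasDerivAt_const (t x) (0 : ℝ)

lemma hasCoeffDerivAt_lowTangent {ι : Type} [Fintype ι] [DecidableEq ι] {n : ℕ} (x : ι)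
    {w : ℕ → (ι → ℝ) → ℝ} {t : ι → ℝ} (hw : ∀ j ∈ Finset.Icc 1 n, DifferentiableAt ℝ (w j) t) :
    HasCoeffDerivAt (fun y => lowTangent n fun j => w j (Function.update t x y))
      (lowTangent n fun j => pderiv x (w j) t) (t x) := fun k => by
  simp only [lowTangent, coeff_mk]
  by_cases hk : 1 ≤ k ∧ k ≤ n
  · simpa only [if_pos hk] using hasDerivAt_pderiv (hw k (Finset.mem_Icc.mpr hk)) x
  · simpa only [if_neg hk] using hasDerivAt_const (t x) (0 : ℝ)

lemma hasCoeffDerivAt_highSeries {ι : Type} [Fintype ι] [DecidableEq ι] {n : ℕ} (x : ι)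
    {w : ℕ → (ι → ℝ) → ℝ} {t : ι → ℝ} (hw : ∀ j ∈ Finset.Icc 1 n, DifferentiableAt ℝ (w j) t) :
    HasCoeffDerivAt (fun y => highSeries n fun j => w j (Function.update t x y))
      (highTangent n fun j => pderiv x (w j) t) (t x) := fun k => by
  simp only [highSeries, highTangent, coeff_mk, coord]
  rcases lt_trichotomy k n with hk | rfl | hk
  · simpa [hk, hk.le, show n - k ≠ 0 by omega] using
      hasDerivAt_pderiv (hw (n - k) (Finset.mem_Icc.mpr (by omega))) x
  · simpa using hasDerivAt_const (t x) (1 : ℝ)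
  · simpa [hk.not_ge, hk.le.not_gt] using hasDerivAt_const (t x) (0 : ℝ)

lemma hasCoeffDerivAt_highTangent {ι : Type} [Fintype ι] [DecidableEq ι] {n : ℕ} (x : ι)
    {w : ℕ → (ι → ℝ) → ℝ} {t : ι → ℝ} (hw : ∀ j ∈ Finset.Icc 1 n, DifferentiableAt ℝ (w j) t) :
    HasCoeffDerivAt (fun y => highTangent n fun j => w j (Function.update t x y))
      (highTangent n fun j => pderiv x (w j) t) (t x) := fun k => by
  simp only [highTangent, coeff_mk]
  by_cases hk : k < n
  · simpa only [if_pos hk] using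
      hasDerivAt_pderiv (hw (n - k) (Finset.mem_Icc.mpr (by omega))) x
  · simpa only [if_neg hk] using hasDerivAt_const (t x) (0 : ℝ)

/-! ### The Euler–Lagrange expressions along a field -/

/-- The `x`-velocities `w_{1,x}, w_{2,x}, …` of the fields at `t`. -/
def velocity {ι : Type} [DecidableEq ι] (x : ι) (w : ℕ → (ι → ℝ) → ℝ) (t : ι → ℝ) : ℕ → ℝ :=
  fun j => pderiv x (w j) t

/-- The second `x`-derivatives `w_{1,xx}, w_{2,xx}, …` of the fields at `t`. -/
def acceleration {ι : Type} [DecidableEq ι] (x : ι) (w : ℕ → (ι → ℝ) → ℝ) (t : ι → ℝ) : ℕ → ℝ :=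
  fun j => pderiv x (pderiv x (w j)) t

/-- In terms of `Q, Q_x, Q_xx` and `P, P_x, P_xx`, the expression `4 E_i` is
`[w^{N+1-i}] (Q_x²/Q² - 2 Q_xx/Q) + [z^{i-N-1}] (2 P_xx/P - P_x²/P²) + [z^{i-1}] 1/P²`. -/
lemma eulerLagrange_eq {ι : Type} [Fintype ι] [DecidableEq ι] {N s i : ℕ} (hi : 1 ≤ i)
    (his : i ≤ s) {U : Set (ι → ℝ)} (hU : IsOpen U) (x : ι) {w : ℕ → (ι → ℝ) → ℝ}
    (hw : ∀ j ∈ Finset.Icc 1 (N + s), ContDiffOn ℝ ∞ (w j) U)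
    (hne : ∀ t ∈ U, w (N + s) t ≠ 0) {t : ι → ℝ} (ht : t ∈ U) :
    eulerLagrange x (N + s) (s : ℤ) (-((N + s : ℕ) : ℤ)) i w t
      = 1 / 4 * (coeff (N + 1) (X ^ i *
            ((lowTangent (N + s) (velocity x w t) * (lowSeries (N + s) fun j => w j t)⁻¹) ^ 2
              - 2 * lowTangent (N + s) (acceleration x w t)
                * (lowSeries (N + s) fun j => w j t)⁻¹))
        + coeff (s - 1) (X ^ (N + s - i) *
            (2 * highTangent (N + s) (acceleration x w t) * (highSeries (N + s) fun j => w j t)⁻¹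
              - (highTangent (N + s) (velocity x w t)
                * (highSeries (N + s) fun j => w j t)⁻¹) ^ 2))
        + coeff (N + s - 1) (X ^ (N + s - i) * (highSeries (N + s) fun j => w j t)⁻¹ ^ 2)) := by
  have hs : 1 ≤ s := hi.trans his
  have hin : i ≤ N + s := by omega
  have hcoord : ∀ t ∈ U, coord (N + s) (fun j => w j t) (N + s) ≠ 0 := fun t ht => by
    rw [coord, if_neg (by omega), if_pos le_rfl]
    exact hne t ht
  have hd : ∀ j ∈ Finset.Icc 1 (N + s), DifferentiableAt ℝ (w j) t := fun j hj =>
    differentiableAt_of_contDiffOn hU (hw j hj) ht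
  have hd' : ∀ j ∈ Finset.Icc 1 (N + s), DifferentiableAt ℝ (pderiv x (w j)) t := fun j hj =>
    differentiableAt_of_contDiffOn hU (contDiffOn_pderiv hU (hw j hj) x) ht
  have hpos := (hasDerivAt_lagrangian_position hs hi hin (velocity x w t) (hcoord t ht)).deriv
  have hvel : pderiv x (fun t' => deriv (fun y => lagrangian (N + s) s (-((N + s : ℕ) : ℤ))
        (fun j => w j t') (Function.update (fun j => pderiv x (w j) t') i y))
        (pderiv x (w i) t')) t
      = 1 / 2 * (coeff (N + 1) (X ^ i *
            (lowTangent (N + s) (acceleration x w t) * (lowSeries (N + s) fun j => w j t)⁻¹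
              - (lowTangent (N + s) (velocity x w t)
                * (lowSeries (N + s) fun j => w j t)⁻¹) ^ 2))
          - coeff (s - 1) (X ^ (N + s - i) *
            (highTangent (N + s) (acceleration x w t) * (highSeries (N + s) fun j => w j t)⁻¹
              - (highTangent (N + s) (velocity x w t)
                * (highSeries (N + s) fun j => w j t)⁻¹) ^ 2))) := by
    have hQ := (hasCoeffDerivAt_lowSeries x hd).inv
      (by rw [constantCoeff_lowSeries]; exact one_ne_zero)
    have hP := (hasCoeffDerivAt_highSeries x hd).inv
      (by rw [constantCoeff_highSeries, Function.update_eq_self]; exact hcoord t ht)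
    have hQ1 := ((HasCoeffDerivAt.const (X ^ i) (t x)).mul
      ((hasCoeffDerivAt_lowTangent x hd').mul hQ)) (N + 1)
    have hP1 := ((HasCoeffDerivAt.const (X ^ (N + s - i)) (t x)).mul
      ((hasCoeffDerivAt_highTangent x hd').mul hP)) (s - 1)
    refine ((((hQ1.sub hP1).const_mul (1 / 2)).congr_of_eventuallyEq ?_).congr_deriv ?_).deriv
    · filter_upwards [eventually_update_mem hU ht x] with y hy
      exact (hasDerivAt_lagrangian_velocity hs hi hin _ (hcoord _ hy)).deriv
    · rw [Function.update_eq_self]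
      simp only [zero_mul, zero_add]
      congr 3
      · unfold velocity acceleration; ring
      · unfold velocity acceleration; ring
  rw [eulerLagrange, hvel]
  refine (congrArg (· - _) hpos).trans ?_
  have e1 : ∀ V A R : ℝ⟦X⟧, X ^ i * ((V * R) ^ 2 - 2 * A * R)
      = -(X ^ i * (V * R) ^ 2) - C (2 : ℝ) * (X ^ i * (A * R - (V * R) ^ 2)) := fun V A R => by
    rw [map_ofNat]; ring
  have e2 : ∀ V A R : ℝ⟦X⟧, X ^ (N + s - i) * (2 * A * R - (V * R) ^ 2)
      = X ^ (N + s - i) * (V * R) ^ 2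
        + C (2 : ℝ) * (X ^ (N + s - i) * (A * R - (V * R) ^ 2)) := fun V A R => by
    rw [map_ofNat]; ring
  rw [e1, e2, map_sub, map_neg, map_add, coeff_C_mul, coeff_C_mul]
  ring

/-! ### The elimination as a single congruence of power series -/

/-- The series `Q_x²/Q² - 2 Q_xx/Q`, for `Q`, `Q₁ = Q_x`, `Q₂ = Q_xx`. -/
def schwarzian (Q Q₁ Q₂ : ℝ⟦X⟧) : ℝ⟦X⟧ := (Q₁ * Q⁻¹) ^ 2 - 2 * Q₂ * Q⁻¹

/-- The polynomial part of `z^N Y(1/z)`, without its term of degree `N`; it is the potential of the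
energy-dependent Schrödinger equation behind the hierarchy. -/
def drift (N : ℕ) (Y : ℝ⟦X⟧) : ℝ⟦X⟧ := mk fun k => if k < N then coeff (N - k) Y else 0

/-- The left-hand side of `1 + B P² + z^N (2 P P_xx - P_x²) = 0`, the equation that the eliminated
variables satisfy modulo `z^s`. -/
def residual (N : ℕ) (B P P₁ P₂ : ℝ⟦X⟧) : ℝ⟦X⟧ := 1 + B * P ^ 2 + X ^ N * (2 * P * P₂ - P₁ ^ 2)

/-- The drift only depends on the coefficients of `Q, Q_x, Q_xx` of degree at most `N`, and can be
found from any solution `R` of `2 Q Q_xx - Q_x² + R Q² = 0` modulo `w^{N+1}`. -/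
lemma drift_schwarzian_eq {N : ℕ} {Q Q₁ Q₂ K K₁ K₂ R : ℝ⟦X⟧} (hQ : constantCoeff Q ≠ 0)
    (h : X ^ (N + 1) ∣ Q - K) (h₁ : X ^ (N + 1) ∣ Q₁ - K₁) (h₂ : X ^ (N + 1) ∣ Q₂ - K₂)
    (hR : X ^ (N + 1) ∣ 2 * K * K₂ - K₁ ^ 2 + R * K ^ 2) :
    drift N (schwarzian Q Q₁ Q₂) = drift N R := by
  have hd : X ^ (N + 1) ∣ R - schwarzian Q Q₁ Q₂ := by
    have hi := PowerSeries.mul_inv_cancel Q hQ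
    have e : R - schwarzian Q Q₁ Q₂ = Q⁻¹ ^ 2 * ((2 * K * K₂ - K₁ ^ 2 + R * K ^ 2)
        + ((Q - K) * (2 * Q₂ + R * (Q + K)) + (Q₂ - K₂) * (2 * K)
          - (Q₁ - K₁) * (Q₁ + K₁))) := by
      rw [schwarzian]
      linear_combination (-R * (1 + Q * Q⁻¹) - 2 * Q₂ * Q⁻¹) * hi
    rw [e]
    exact Dvd.dvd.mul_left (dvd_add hR (dvd_sub (dvd_add (h.mul_right _) (h₂.mul_right _))
      (h₁.mul_right _))) _
  ext k
  simp only [drift, coeff_mk]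
  split_ifs with hk
  · have := X_pow_dvd_iff.mp hd (N - k) (by omega)
    rw [map_sub, sub_eq_zero] at this
    exact this.symm
  · rfl

lemma two_mul_add_schwarzian {Q Q₁ Q₂ : ℝ⟦X⟧} (hQ : constantCoeff Q ≠ 0) :
    2 * Q * Q₂ - Q₁ ^ 2 + schwarzian Q Q₁ Q₂ * Q ^ 2 = 0 := by
  have hi := PowerSeries.mul_inv_cancel Q hQ
  rw [schwarzian]
  linear_combination (Q₁ ^ 2 * (1 + Q * Q⁻¹) - 2 * Q₂ * Q) * hi

/-- The potential `B` computed from the fields `w_1, …, w_n`. -/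
def driftAt {ι : Type} [DecidableEq ι] (x : ι) (N n : ℕ) (w : ℕ → (ι → ℝ) → ℝ) (t : ι → ℝ) :
    ℝ⟦X⟧ :=
  drift N (schwarzian (lowSeries n fun j => w j t) (lowTangent n (velocity x w t))
    (lowTangent n (acceleration x w t)))

lemma eulerLagrange_eq_coeff {ι : Type} [Fintype ι] [DecidableEq ι] {N s i : ℕ} (hi : 1 ≤ i)
    (his : i ≤ s) {U : Set (ι → ℝ)} (hU : IsOpen U) (x : ι) {w : ℕ → (ι → ℝ) → ℝ}
    (hw : ∀ j ∈ Finset.Icc 1 (N + s), ContDiffOn ℝ ∞ (w j) U)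
    (hne : ∀ t ∈ U, w (N + s) t ≠ 0) {t : ι → ℝ} (ht : t ∈ U) :
    eulerLagrange x (N + s) (s : ℤ) (-((N + s : ℕ) : ℤ)) i w t
      = 1 / 4 * coeff (i - 1) ((highSeries (N + s) fun j => w j t)⁻¹ ^ 2
        * residual N (driftAt x N (N + s) w t) (highSeries (N + s) fun j => w j t)
          (highTangent (N + s) (velocity x w t)) (highTangent (N + s) (acceleration x w t))) := by
  have hP : highSeries (N + s) (fun j => w j t) * (highSeries (N + s) fun j => w j t)⁻¹ = 1 :=
    highSeries_mul_inv (by rw [coord, if_neg (by omega), if_pos le_rfl]; exact hne t ht)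
  have e : (highSeries (N + s) fun j => w j t)⁻¹ ^ 2
        * residual N (driftAt x N (N + s) w t) (highSeries (N + s) fun j => w j t)
          (highTangent (N + s) (velocity x w t)) (highTangent (N + s) (acceleration x w t))
      = driftAt x N (N + s) w t
        + X ^ N * (2 * highTangent (N + s) (acceleration x w t)
            * (highSeries (N + s) fun j => w j t)⁻¹
          - (highTangent (N + s) (velocity x w t) * (highSeries (N + s) fun j => w j t)⁻¹) ^ 2)
        + (highSeries (N + s) fun j => w j t)⁻¹ ^ 2 := by
    rw [residual]
    linear_combination (driftAt x N (N + s) w t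
        * (1 + highSeries (N + s) (fun j => w j t) * (highSeries (N + s) fun j => w j t)⁻¹)
      + 2 * X ^ N * highTangent (N + s) (acceleration x w t)
        * (highSeries (N + s) fun j => w j t)⁻¹) * hP
  rw [eulerLagrange_eq hi his hU x hw hne ht, e, map_add, map_add]
  refine congrArg _ (congrArg₂ _ (congrArg₂ _ ?_ ?_) ?_)
  · rw [coeff_X_pow_mul', driftAt, drift, coeff_mk]
    rcases lt_trichotomy i (N + 1) with h | rfl | h
    · rw [if_pos h.le, if_pos (by omega), show N - (i - 1) = N + 1 - i by omega]
      rfl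
    · rw [if_pos le_rfl, if_neg (by omega), Nat.sub_self]
      simp [lowTangent]
    · rw [if_neg (by omega), if_neg (by omega)]
  · rw [coeff_X_pow_mul', coeff_X_pow_mul']
    by_cases h : N ≤ i - 1
    · rw [if_pos h, if_pos (by omega), show s - 1 - (N + s - i) = i - 1 - N by omega]
    · rw [if_neg h, if_neg (by omega)]
  · rw [coeff_X_pow_mul', if_pos (by omega), show N + s - 1 - (N + s - i) = i - 1 by omega]

/-- All the Euler–Lagrange equations that define the elimination hold at `t` if and only if the
residual vanishes modulo `z^s`. -/
lemma eulerLagrange_eq_zero_iff {ι : Type} [Fintype ι] [DecidableEq ι] {N s : ℕ}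
    {U : Set (ι → ℝ)} (hU : IsOpen U) (x : ι) {w : ℕ → (ι → ℝ) → ℝ}
    (hw : ∀ j ∈ Finset.Icc 1 (N + s), ContDiffOn ℝ ∞ (w j) U) (hNs : 1 ≤ N + s)
    (hne : ∀ t ∈ U, w (N + s) t ≠ 0) {t : ι → ℝ} (ht : t ∈ U) :
    (∀ i ∈ Finset.Icc 1 s, eulerLagrange x (N + s) (s : ℤ) (-((N + s : ℕ) : ℤ)) i w t = 0) ↔
      X ^ s ∣ residual N (driftAt x N (N + s) w t) (highSeries (N + s) fun j => w j t)
          (highTangent (N + s) (velocity x w t)) (highTangent (N + s) (acceleration x w t)) := by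
  have hP : highSeries (N + s) (fun j => w j t) * (highSeries (N + s) fun j => w j t)⁻¹ = 1 :=
    highSeries_mul_inv (by rw [coord, if_neg (by omega), if_pos le_rfl]; exact hne t ht)
  have hu : IsUnit ((highSeries (N + s) fun j => w j t)⁻¹ ^ 2) :=
    (IsUnit.of_mul_eq_one _ (by rw [mul_comm]; exact hP)).pow 2
  rw [← hu.dvd_mul_left, X_pow_dvd_iff]
  constructor
  · intro h m hm
    have := h (m + 1) (Finset.mem_Icc.mpr (by omega))
    rw [eulerLagrange_eq_coeff (by omega) (by omega) hU x hw hne ht] at this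
    simpa using this
  · intro h i hi
    rw [Finset.mem_Icc] at hi
    rw [eulerLagrange_eq_coeff hi.1 hi.2 hU x hw hne ht, h _ (by omega), mul_zero]

/-! ### Uniqueness of the elimination -/

lemma assemble_of_le {X : Type} {N s j : ℕ} (h : j ≤ N) (u f : ℕ → X) :
    assemble N s u f j = u j := if_pos h

lemma assemble_of_gt {X : Type} {N s j : ℕ} (h : N < j) (u f : ℕ → X) :
    assemble N s u f j = f (N + s + 1 - j) := if_neg (by omega)

lemma contDiffOn_assemble {ι : Type} [Fintype ι] {N s : ℕ} {U : Set (ι → ℝ)}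
    {u f : ℕ → (ι → ℝ) → ℝ} (hu : ∀ j ∈ Finset.Icc 1 N, ContDiffOn ℝ ∞ (u j) U)
    (hf : ∀ a ∈ Finset.Icc 1 s, ContDiffOn ℝ ∞ (f a) U) :
    ∀ j ∈ Finset.Icc 1 (N + s), ContDiffOn ℝ ∞ (assemble N s u f j) U := by
  intro j hj
  rw [Finset.mem_Icc] at hj
  by_cases h : j ≤ N
  · rw [assemble_of_le h]; exact hu j (Finset.mem_Icc.mpr ⟨hj.1, h⟩)
  · rw [assemble_of_gt (by omega)]; exact hf _ (Finset.mem_Icc.mpr (by omega))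

lemma coeff_highSeries_assemble {ι : Type} {N s k : ℕ} (hk : k < s) (u f : ℕ → (ι → ℝ) → ℝ)
    (t : ι → ℝ) : coeff k (highSeries (N + s) fun j => assemble N s u f j t) = f (k + 1) t := by
  rw [highSeries, coeff_mk, if_pos (by omega), coord, if_neg (by omega), if_pos (by omega),
    assemble_of_gt (by omega), show N + s + 1 - (N + s - k) = k + 1 by omega]

lemma coeff_highTangent_assemble {ι : Type} [DecidableEq ι] (x : ι) {N s k : ℕ} (hk : k < s)
    (u f : ℕ → (ι → ℝ) → ℝ) (t : ι → ℝ) :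
    coeff k (highTangent (N + s) (velocity x (assemble N s u f) t)) = pderiv x (f (k + 1)) t := by
  rw [highTangent, coeff_mk, if_pos (by omega), velocity,
    assemble_of_gt (by omega), show N + s + 1 - (N + s - k) = k + 1 by omega]

lemma coeff_highTangent_acceleration_assemble {ι : Type} [DecidableEq ι] (x : ι) {N s k : ℕ}
    (hk : k < s) (u f : ℕ → (ι → ℝ) → ℝ) (t : ι → ℝ) :
    coeff k (highTangent (N + s) (acceleration x (assemble N s u f) t))
      = pderiv x (pderiv x (f (k + 1))) t := by
  rw [highTangent, coeff_mk, if_pos (by omega), acceleration,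
    assemble_of_gt (by omega), show N + s + 1 - (N + s - k) = k + 1 by omega]

/-- The potential `B` of assembled fields is determined by `u_1, …, u_N`. -/
lemma driftAt_assemble_congr {ι : Type} [DecidableEq ι] (x : ι) (N s : ℕ)
    (u f g : ℕ → (ι → ℝ) → ℝ) (t : ι → ℝ) :
    driftAt x N (N + s) (assemble N s u f) t = driftAt x N (N + s) (assemble N s u g) t := by
  have h0 : ∀ w : ℕ → (ι → ℝ) → ℝ, constantCoeff (lowSeries (N + s) fun j => w j t) ≠ 0 :=
    fun w => by rw [constantCoeff_lowSeries]; exact one_ne_zero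
  refine drift_schwarzian_eq (h0 _) ?_ ?_ ?_ (by rw [two_mul_add_schwarzian (h0 _)]; simp) <;>
  · refine X_pow_dvd_iff.mpr fun m hm => ?_
    simp only [lowSeries, lowTangent, velocity, acceleration, coord, map_sub, coeff_mk,
      assemble_of_le (Nat.lt_succ_iff.mp hm), sub_self]

lemma elimination_unique {ι : Type} [Fintype ι] [DecidableEq ι] {x : ι} {N s : ℕ} (hN : 1 ≤ N)
    {η : ℝ} {U : Set (ι → ℝ)} (hU : IsOpen U) {u f g : ℕ → (ι → ℝ) → ℝ}
    (hu : ∀ j ∈ Finset.Icc 1 N, ContDiffOn ℝ ∞ (u j) U)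
    (hf : IsElimination x N s η U u f) (hg : IsElimination x N s η U u g) :
    ∀ a ∈ Finset.Icc 1 s, Set.EqOn (f a) (g a) U := by
  suffices H : ∀ k < s, Set.EqOn (f (k + 1)) (g (k + 1)) U by
    intro a ha
    rw [Finset.mem_Icc] at ha
    have := H (a - 1) (by omega)
    rwa [show a - 1 + 1 = a by omega] at this
  intro k
  induction k using Nat.strong_induction_on with
  | _ k ih =>
    intro hk t ht
    have hres : ∀ h : ℕ → (ι → ℝ) → ℝ, IsElimination x N s η U u h → X ^ s ∣
        residual N (driftAt x N (N + s) (assemble N s u h) t)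
          (highSeries (N + s) fun j => assemble N s u h j t)
          (highTangent (N + s) (velocity x (assemble N s u h) t))
          (highTangent (N + s) (acceleration x (assemble N s u h) t)) := by
      intro h hh
      refine (eulerLagrange_eq_zero_iff hU x (contDiffOn_assemble hu hh.smooth) (by omega)
        (fun t ht h0 => ?_) ht).mp fun i hi => hh.euler i hi t ht
      rw [assemble_of_gt (by omega), show N + s + 1 - (N + s) = 1 by omega] at h0
      exact (hh.branch t ht).ne' (by rw [h0, mul_zero])
    have hF := hres f hf
    have hG := hres g hg
    rw [driftAt_assemble_congr x N s u g f] at hG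
    have hc : ∀ h : ℕ → (ι → ℝ) → ℝ,
        constantCoeff (highSeries (N + s) fun j => assemble N s u h j t) = h 1 t := fun h => by
      rw [← coeff_zero_eq_constantCoeff_apply, coeff_highSeries_assemble (by omega)]
    have hD : X ^ k ∣ highSeries (N + s) (fun j => assemble N s u f j t)
        - highSeries (N + s) fun j => assemble N s u g j t := by
      refine X_pow_dvd_iff.mpr fun m hm => ?_
      rw [map_sub, coeff_highSeries_assemble (by omega), coeff_highSeries_assemble (by omega),
        ih m hm (by omega) ht, sub_self]
    have hD1 : X ^ k ∣ highTangent (N + s) (velocity x (assemble N s u f) t)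
        - highTangent (N + s) (velocity x (assemble N s u g) t) := by
      refine X_pow_dvd_iff.mpr fun m hm => ?_
      rw [map_sub, coeff_highTangent_assemble x (by omega),
        coeff_highTangent_assemble x (by omega),
        pderiv_congr hU (ih m hm (by omega)) ht, sub_self]
    have hD2 : X ^ k ∣ highTangent (N + s) (acceleration x (assemble N s u f) t)
        - highTangent (N + s) (acceleration x (assemble N s u g) t) := by
      refine X_pow_dvd_iff.mpr fun m hm => ?_
      have hp : Set.EqOn (pderiv x (f (m + 1))) (pderiv x (g (m + 1))) U := fun t' ht' =>
        pderiv_congr hU (ih m hm (by omega)) ht' x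
      rw [map_sub, coeff_highTangent_acceleration_assemble x (by omega),
        coeff_highTangent_acceleration_assemble x (by omega), pderiv_congr hU hp ht, sub_self]
    have hcf := hc f
    have hcg := hc g
    have hkf := coeff_highSeries_assemble (N := N) hk u f t
    have hkg := coeff_highSeries_assemble (N := N) hk u g t
    generalize driftAt x N (N + s) (assemble N s u f) t = B at hF hG
    generalize highSeries (N + s) (fun j => assemble N s u f j t) = F at *
    generalize highSeries (N + s) (fun j => assemble N s u g j t) = G at *
    generalize highTangent (N + s) (velocity x (assemble N s u f) t) = F₁ at *
    generalize highTangent (N + s) (velocity x (assemble N s u g) t) = G₁ at *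
    generalize highTangent (N + s) (acceleration x (assemble N s u f) t) = F₂ at *
    generalize highTangent (N + s) (acceleration x (assemble N s u g) t) = G₂ at *
    obtain ⟨E, hE⟩ := hD
    obtain ⟨E₁, hE₁⟩ := hD1
    obtain ⟨E₂, hE₂⟩ := hD2
    have hB : constantCoeff B ≠ 0 := by
      intro hB
      have := X_pow_dvd_iff.mp hF 0 (by omega)
      rw [coeff_zero_eq_constantCoeff_apply, residual] at this
      simp [hB, show N ≠ 0 by omega] at this
    -- Subtracting the two residuals leaves `B (F + G) (F - G)` as the term of lowest order.
    have hdiff : residual N B F F₁ F₂ - residual N B G G₁ G₂ = X ^ k * (B * (F + G) * E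
        + X ^ N * (2 * (F * E₂ + E * G₂) - (F₁ + G₁) * E₁)) := by
      rw [residual, residual]
      linear_combination (B * (F + G) + 2 * X ^ N * G₂) * hE + 2 * X ^ N * F * hE₂
        - X ^ N * (F₁ + G₁) * hE₁
    have hzero : constantCoeff (B * (F + G) * E
        + X ^ N * (2 * (F * E₂ + E * G₂) - (F₁ + G₁) * E₁)) = 0 := by
      have := X_pow_dvd_iff.mp (dvd_sub hF hG) k hk
      rwa [hdiff, coeff_X_pow_mul', if_pos le_rfl, Nat.sub_self,
        coeff_zero_eq_constantCoeff_apply] at this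
    have hsum : f 1 t + g 1 t ≠ 0 := fun h => by
      have h1 := hf.branch t ht
      have h2 := hg.branch t ht
      have : η * (f 1 t + g 1 t) = 0 := by rw [h, mul_zero]
      linarith
    have hE0 : constantCoeff E = 0 := by
      simpa [hB, hcf, hcg, hsum, show N ≠ 0 by omega] using hzero
    have := congrArg (coeff k) hE
    rw [map_sub, hkf, hkg, coeff_X_pow_mul', if_pos le_rfl, Nat.sub_self,
      coeff_zero_eq_constantCoeff_apply, hE0, sub_eq_zero] at this
    exact this

end HarryDym

namespace HarryDym

open Filter Topology

/-! ### Viète polynomials and Horner sums -/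

/-- The monic polynomial `p(z) = ∏_r (z - λ_r) = ∑_j q_j z^{n-j}`. -/
def rootPoly {n : ℕ} (l : Fin n → ℝ) : Polynomial ℝ :=
  ∏ r, (Polynomial.X - Polynomial.C (l r))

/-- The cofactor `p(z) / (z - λ_r) = ∏_{s ≠ r} (z - λ_s)`. -/
def cofactor {n : ℕ} (l : Fin n → ℝ) (r : Fin n) : Polynomial ℝ :=
  ∏ s ∈ Finset.univ.erase r, (Polynomial.X - Polynomial.C (l s))

/-- The Horner sums `ρ_k = ∑_{j < k} q_j λ_r^{k-1-j}` of `p` at its root `λ_r`; they are the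
coefficients of the cofactor, and `-ρ_k` is the partial derivative of `q_k` with respect to
`λ_r`. -/
def horner {n : ℕ} (l : Fin n → ℝ) (r : Fin n) : ℕ → ℝ
  | 0 => 0
  | k + 1 => l r * horner l r k + viete l k

lemma viete_zero {n : ℕ} (l : Fin n → ℝ) : viete l 0 = 1 := by simp [viete]

lemma viete_of_lt {n j : ℕ} (l : Fin n → ℝ) (h : n < j) : viete l j = 0 := by
  rw [viete, Finset.powersetCard_eq_empty.mpr (by simpa using h), Finset.sum_empty, mul_zero]

lemma viete_self {n : ℕ} (l : Fin n → ℝ) : viete l n = (-1) ^ n * ∏ r, l r := by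
  have : Finset.powersetCard n (Finset.univ : Finset (Fin n)) = {Finset.univ} := by
    simpa using Finset.powersetCard_self (Finset.univ : Finset (Fin n))
  rw [viete, this, Finset.sum_singleton]

lemma coeff_rootPoly {n k : ℕ} (l : Fin n → ℝ) (h : k ≤ n) :
    (rootPoly l).coeff k = viete l (n - k) := by
  have h1 := Multiset.prod_X_sub_C_coeff ((Finset.univ : Finset (Fin n)).val.map l) (k := k)
    (by simpa using h)
  rw [Multiset.map_map, Finset.esymm_map_val, Multiset.card_map, Finset.card_val,
    Finset.card_univ, Fintype.card_fin] at h1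
  exact h1

lemma monic_rootPoly {n : ℕ} (l : Fin n → ℝ) : (rootPoly l).Monic :=
  Polynomial.monic_prod_of_monic _ _ fun r _ => Polynomial.monic_X_sub_C (l r)

lemma natDegree_rootPoly {n : ℕ} (l : Fin n → ℝ) : (rootPoly l).natDegree = n := by
  simp [rootPoly, Polynomial.natDegree_finsetProd_X_sub_C_eq_card]

lemma eval_rootPoly {n : ℕ} (l : Fin n → ℝ) (r : Fin n) : (rootPoly l).eval (l r) = 0 := by
  rw [rootPoly, Polynomial.eval_prod]
  exact Finset.prod_eq_zero (Finset.mem_univ r) (by simp)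

lemma rootPoly_eq_mul_cofactor {n : ℕ} (l : Fin n → ℝ) (r : Fin n) :
    rootPoly l = (Polynomial.X - Polynomial.C (l r)) * cofactor l r :=
  (Finset.mul_prod_erase _ _ (Finset.mem_univ r)).symm

lemma natDegree_cofactor {n : ℕ} (l : Fin n → ℝ) (r : Fin n) :
    (cofactor l r).natDegree = n - 1 := by
  simp [cofactor, Polynomial.natDegree_finsetProd_X_sub_C_eq_card]

lemma eval_cofactor_of_ne {n : ℕ} (l : Fin n → ℝ) {r s : Fin n} (h : s ≠ r) :
    (cofactor l r).eval (l s) = 0 := by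
  rw [cofactor, Polynomial.eval_prod]
  exact Finset.prod_eq_zero (Finset.mem_erase.mpr ⟨h, Finset.mem_univ s⟩) (by simp)

lemma eval_cofactor_ne_zero {n : ℕ} {l : Fin n → ℝ} (hl : Function.Injective l) (r : Fin n) :
    (cofactor l r).eval (l r) ≠ 0 := by
  rw [cofactor, Polynomial.eval_prod, Finset.prod_ne_zero_iff]
  intro s hs
  simpa [sub_eq_zero] using fun h => (Finset.mem_erase.mp hs).1 (hl h).symm

lemma eval_derivative_rootPoly {n : ℕ} (l : Fin n → ℝ) (r : Fin n) :
    (Polynomial.derivative (rootPoly l)).eval (l r) = (cofactor l r).eval (l r) := by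
  rw [rootPoly_eq_mul_cofactor l r]
  simp [Polynomial.derivative_mul]

lemma coeff_cofactor {n : ℕ} (l : Fin n → ℝ) (r : Fin n) :
    ∀ j ≤ n, (cofactor l r).coeff (n - j) = horner l r j := by
  intro j
  induction j with
  | zero =>
    intro _
    refine Polynomial.coeff_eq_zero_of_natDegree_lt ?_
    rw [natDegree_cofactor]
    have := r.pos
    omega
  | succ j ih =>
    intro hj
    have h1 := coeff_rootPoly l (k := n - (j + 1) + 1) (by omega)
    rw [rootPoly_eq_mul_cofactor l r, sub_mul, Polynomial.coeff_sub, Polynomial.coeff_X_mul,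
      Polynomial.coeff_C_mul, show n - (j + 1) + 1 = n - j by omega, ih (by omega),
      show n - (n - j) = j by omega] at h1
    rw [horner, ← h1]
    ring

/-- Beyond the degree the Horner sums vanish, as `ρ_{n+1} = p(λ_r) = 0`. -/
lemma horner_of_lt {n j : ℕ} (l : Fin n → ℝ) (r : Fin n) (h : n < j) : horner l r j = 0 := by
  induction j, h using Nat.le_induction with
  | base =>
    have h1 := coeff_cofactor l r n le_rfl
    have h2 := coeff_rootPoly l (k := 0) (by omega)
    rw [Nat.sub_self] at h1
    rw [rootPoly_eq_mul_cofactor l r, Polynomial.mul_coeff_zero, h1, Nat.sub_zero] at h2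
    rw [horner, ← h2]
    simp
  | succ j hj ih => rw [horner, ih, viete_of_lt l hj, mul_zero, add_zero]

lemma eval_cofactor {n : ℕ} (l : Fin n → ℝ) (r : Fin n) (y : ℝ) :
    (cofactor l r).eval y = ∑ i ∈ Finset.range n, horner l r (i + 1) * y ^ (n - 1 - i) := by
  have hn : (cofactor l r).natDegree < n := by
    rw [natDegree_cofactor]; have := r.pos; omega
  rw [Polynomial.eval_eq_sum_range' hn, ← Finset.sum_range_reflect]
  refine Finset.sum_congr rfl fun i hi => ?_
  rw [Finset.mem_range] at hi
  rw [← coeff_cofactor l r _ hi, show n - 1 - i = n - (i + 1) by omega]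

/-- Solving a Vandermonde system `∑_s λ_s^{n-1-i} m_s = b_i` by testing it against a cofactor. -/
lemma eval_cofactor_mul {n : ℕ} (l m b : Fin n → ℝ)
    (h : ∀ i : Fin n, ∑ s, l s ^ (n - 1 - (i : ℕ)) * m s = b i) (r : Fin n) :
    (cofactor l r).eval (l r) * m r = ∑ i : Fin n, horner l r (i + 1) * b i := by
  have h1 : ∑ s, (cofactor l r).eval (l s) * m s = (cofactor l r).eval (l r) * m r :=
    Finset.sum_eq_single r (fun s _ hs => by rw [eval_cofactor_of_ne l hs, zero_mul])
      (fun hr => absurd (Finset.mem_univ r) hr)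
  rw [← h1]
  simp_rw [← h, eval_cofactor, Finset.sum_range, Finset.sum_mul, Finset.mul_sum]
  rw [Finset.sum_comm]
  exact Finset.sum_congr rfl fun i _ => Finset.sum_congr rfl fun s _ => by ring

/-! ### Smoothness of implicitly given roots -/

lemma contDiffAt_zpow_of_ne_zero {y : ℝ} (hy : y ≠ 0) (k : ℤ) :
    ContDiffAt ℝ ∞ (fun y : ℝ => y ^ k) y := by
  cases k with
  | ofNat k => simpa using (contDiff_id.pow k).contDiffAt
  | negSucc k =>
    simp only [zpow_negSucc]
    exact ((contDiff_id.pow (k + 1)).contDiffAt).inv (pow_ne_zero _ hy)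

lemma contDiffAt_radicand (n N β : ℕ) (a : Fin n → ℝ) {y : ℝ} (hy : y ≠ 0) :
    ContDiffAt ℝ ∞ (radicand n N β a) y := by
  refine (contDiffAt_zpow_of_ne_zero hy _).mul (ContDiffAt.add ?_
    (contDiffAt_const.mul (contDiffAt_zpow_of_ne_zero hy _)))
  exact ContDiffAt.sum fun j _ => contDiffAt_const.mul (contDiff_id.pow _).contDiffAt

lemma contDiffOn_of_hasDerivAt {J : Set ℝ} (hJ : IsOpen J) {φ ψ : ℝ → ℝ}
    (hφ : ∀ y ∈ J, HasDerivAt φ (ψ y) y) (hψ : ContDiffOn ℝ ∞ ψ J) : ContDiffOn ℝ ∞ φ J :=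
  (contDiffOn_infty_iff_deriv_of_isOpen hJ).mpr
    ⟨fun y hy => (hφ y hy).differentiableAt.differentiableWithinAt,
      hψ.congr fun y hy => (hφ y hy).deriv⟩

/-- A continuous right inverse of a smooth map with invertible derivative is smooth. -/
lemma contDiffAt_of_comp_eq {E F : Type*} [NormedAddCommGroup E] [NormedSpace ℝ E]
    [CompleteSpace E] [NormedAddCommGroup F] [NormedSpace ℝ F] {G : Type*} [NormedAddCommGroup G]
    [NormedSpace ℝ G] {H : E → F} {L : G → E} {T : G → F} {t : G} {H' : E ≃L[ℝ] F}
    (hH : ContDiffAt ℝ ∞ H (L t)) (hH' : HasFDerivAt H (H' : E →L[ℝ] F) (L t))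
    (hL : ContinuousAt L t) (hT : ContDiffAt ℝ ∞ T t) (h : ∀ᶠ t' in 𝓝 t, H (L t') = T t') :
    ContDiffAt ℝ ∞ L t := by
  have hn : (∞ : WithTop ℕ∞) ≠ 0 := by simp
  have h1 : ∀ᶠ t' in 𝓝 t, L t' = hH.localInverse hH' hn (T t') := by
    have h2 := (hH.hasStrictFDerivAt' hH' hn).eventually_left_inverse
    filter_upwards [hL.eventually h2, h] with t' h3 h4
    rw [← h4]
    exact h3.symm
  have h5 : ContDiffAt ℝ ∞ (hH.localInverse hH' hn) (T t) := by
    rw [← h.self_of_nhds]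
    exact hH.to_localInverse hH' hn
  exact (h5.comp t hT).congr_of_eventuallyEq h1

lemma contDiffOn_lam {n N β : ℕ} {a c : Fin n → ℝ} {U : Set (Fin n → ℝ)} (hU : IsOpen U)
    {lam : Fin n → (Fin n → ℝ) → ℝ} (h : IsImplicitSolution n N β a c U lam) (r : Fin n) :
    ContDiffOn ℝ ∞ (lam r) U := by
  obtain ⟨hcont, hinj, σ, J, Φ, hσ, hJ, hpos, hΦ, hmem, heq⟩ := h
  intro t ht
  have hsq : ∀ r, √(radicand n N β a (lam r t)) ≠ 0 := fun r =>
    (Real.sqrt_pos.mpr (hpos r _ (hmem r t ht)).2).ne'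
  have hsm : ∀ i r, ContDiffOn ℝ ∞ (Φ i r) (J r) := fun i r =>
    contDiffOn_of_hasDerivAt (hJ r) (hΦ i r) fun y hy =>
      (((contDiff_id.pow _).contDiffAt).div ((contDiffAt_radicand n N β a (hpos r y hy).1).sqrt
        (hpos r y hy).2.ne') (Real.sqrt_pos.mpr (hpos r y hy).2).ne').contDiffWithinAt
  let H : (Fin n → ℝ) → Fin n → ℝ := fun l i => 1 / 2 * ∑ r, σ r * Φ i r (l r)
  let A : (Fin n → ℝ) →L[ℝ] (Fin n → ℝ) := ContinuousLinearMap.pi fun i =>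
    (1 / 2 : ℝ) • ∑ r, (σ r * (lam r t ^ (n - 1 - (i : ℕ)) / √(radicand n N β a (lam r t)))) •
      (ContinuousLinearMap.proj r : (Fin n → ℝ) →L[ℝ] ℝ)
  have hA : Function.Injective (A : (Fin n → ℝ) →ₗ[ℝ] (Fin n → ℝ)) := by
    rw [← LinearMap.ker_eq_bot, LinearMap.ker_eq_bot']
    intro v hv
    have hsum := eval_cofactor_mul (fun r => lam r t)
      (fun r => σ r * v r / √(radicand n N β a (lam r t))) 0 fun i => by
        have := congrFun hv i
        simp only [ContinuousLinearMap.coe_coe, A, ContinuousLinearMap.coe_pi',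
          smul_apply, sum_apply,
          ContinuousLinearMap.proj_apply, smul_eq_mul, Pi.zero_apply] at this
        rw [Pi.zero_apply]
        refine Eq.trans ?_ ((mul_eq_zero.mp this).resolve_left (by norm_num))
        exact Finset.sum_congr rfl fun r _ => by ring
    funext r
    have hr := hsum r
    simp only [Pi.zero_apply, mul_zero, Finset.sum_const_zero, mul_eq_zero, div_eq_zero_iff,
      hsq r, eval_cofactor_ne_zero (hinj t ht) r, false_or, or_false] at hr
    refine hr.resolve_left ?_
    rcases hσ r with h | h <;> rw [h] <;> norm_num
  let A' : (Fin n → ℝ) ≃L[ℝ] (Fin n → ℝ) :=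
    (LinearEquiv.ofInjectiveEndo (A : (Fin n → ℝ) →ₗ[ℝ] (Fin n → ℝ)) hA).toContinuousLinearEquiv
  have hA' : (A' : (Fin n → ℝ) →L[ℝ] (Fin n → ℝ)) = A := rfl
  have hHs : ContDiffAt ℝ ∞ H (fun r => lam r t) := by
    refine contDiffAt_pi.mpr fun i => contDiffAt_const.mul (ContDiffAt.sum fun r _ =>
      contDiffAt_const.mul ?_)
    exact ((hsm i r).contDiffAt ((hJ r).mem_nhds (hmem r t ht))).comp (fun r => lam r t)
      (contDiff_apply ℝ ℝ r).contDiffAt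
  have hHd : HasFDerivAt H (A' : (Fin n → ℝ) →L[ℝ] (Fin n → ℝ)) (fun r => lam r t) := by
    rw [hA', hasFDerivAt_pi']
    intro i
    have h1 : ∀ r, HasFDerivAt (fun l : Fin n → ℝ => Φ i r (l r))
        ((lam r t ^ (n - 1 - (i : ℕ)) / √(radicand n N β a (lam r t))) •
          (ContinuousLinearMap.proj r : (Fin n → ℝ) →L[ℝ] ℝ)) (fun r => lam r t) := fun r =>
      HasDerivAt.comp_hasFDerivAt (fun r => lam r t) (hΦ i r _ (hmem r t ht))
        (hasFDerivAt_apply r _)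
    have h2 := (HasFDerivAt.fun_sum fun r (_ : r ∈ Finset.univ) =>
      (h1 r).const_mul (σ r)).const_mul (1 / 2 : ℝ)
    refine h2.congr_fderiv ?_
    ext v
    simp [A, mul_assoc]
  have hcontL : ContinuousAt (fun t r => lam r t) t :=
    continuousAt_pi.mpr fun r => (hcont r).continuousAt (hU.mem_nhds ht)
  have hT : ContDiffAt ℝ ∞ (fun t : Fin n → ℝ => t + c) t :=
    (contDiff_id.add contDiff_const).contDiffAt
  have hEq : ∀ᶠ t' in 𝓝 t, H (fun r => lam r t') = t' + c := by
    filter_upwards [hU.mem_nhds ht] with t' ht'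
    funext i
    exact (heq i t' ht').symm
  exact ((contDiffAt_pi.mp (contDiffAt_of_comp_eq hHs hHd hcontL hT hEq)) r).contDiffWithinAt

/-- Differentiating the implicit relations and solving the resulting Vandermonde system: with
`p` the monic polynomial with the roots `λ_r`, one has
`p'(λ_r) ∂λ_r/∂t_k = 2 σ_r √(radicand (λ_r)) ρ_k(λ_r)`. -/
lemma exists_pderiv_lam {n N β : ℕ} {a c : Fin n → ℝ} {U : Set (Fin n → ℝ)} (hU : IsOpen U)
    {lam : Fin n → (Fin n → ℝ) → ℝ} (h : IsImplicitSolution n N β a c U lam) :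
    ∃ σ : Fin n → ℝ, (∀ r, σ r ^ 2 = 1) ∧ ∀ t ∈ U, ∀ r k,
      (cofactor (fun s => lam s t) r).eval (lam r t) * pderiv k (lam r) t
        = 2 * σ r * √(radicand n N β a (lam r t)) * horner (fun s => lam s t) r (k + 1) := by
  have hsmooth := fun r => contDiffOn_lam hU h r
  obtain ⟨hcont, hinj, σ, J, Φ, hσ, hJ, hpos, hΦ, hmem, heq⟩ := h
  refine ⟨σ, fun r => by rcases hσ r with h | h <;> rw [h] <;> norm_num, fun t ht r k => ?_⟩
  have hsq : ∀ r, √(radicand n N β a (lam r t)) ≠ 0 := fun r =>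
    (Real.sqrt_pos.mpr (hpos r _ (hmem r t ht)).2).ne'
  have hσ2 : σ r * σ r = 1 := by rcases hσ r with h | h <;> rw [h] <;> norm_num
  have hsum := eval_cofactor_mul (fun r => lam r t)
    (fun r => 1 / 2 * σ r * pderiv k (lam r) t / √(radicand n N β a (lam r t)))
    (fun i => if i = k then 1 else 0) (fun i => by
      have hd : ∀ r, HasDerivAt (fun y => Φ i r (lam r (Function.update t k y)))
          (lam r t ^ (n - 1 - (i : ℕ)) / √(radicand n N β a (lam r t)) * pderiv k (lam r) t)
          (t k) := fun r => by
        have h1 := hasDerivAt_pderiv (differentiableAt_of_contDiffOn hU (hsmooth r) ht) k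
        have h2 := hΦ i r _ (hmem r t ht)
        rw [← Function.update_eq_self k t] at h2
        have h3 := h2.comp (t k) h1
        rwa [Function.update_eq_self k t] at h3
      have h1 := (HasDerivAt.fun_sum fun r (_ : r ∈ Finset.univ) =>
        (hd r).const_mul (σ r)).const_mul (1 / 2 : ℝ)
      have h2 : HasDerivAt (fun y => Function.update t k y i + c i) (if i = k then 1 else 0)
          (t k) := by
        by_cases hik : i = k
        · subst hik
          simpa using (hasDerivAt_id' (t i)).add_const (c i)
        · simpa [hik] using hasDerivAt_const (t k) (t i + c i)
      have h3 := h1.unique (h2.congr_of_eventuallyEq (by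
        filter_upwards [eventually_update_mem hU ht k] with y hy
        exact (heq i _ hy).symm))
      rw [← h3, Finset.mul_sum]
      exact Finset.sum_congr rfl fun r _ => by ring) r
  simp only [mul_ite, mul_one, mul_zero, Finset.sum_ite_eq', Finset.mem_univ, if_true] at hsum
  rw [← hsum]
  field_simp [hsq r]
  linear_combination (-(cofactor (fun s => lam s t) r).eval (lam r t) * pderiv k (lam r) t) * hσ2

/-! ### The flows on Viète coordinates -/

/-- The Horner sums turn the Killing fields into products: the value of a Killing field at a single
root factorizes. -/
lemma horner_mul_horner {n : ℕ} (l : Fin n → ℝ) (r : Fin n) (j : ℕ) : ∀ i,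
    horner l r i * horner l r j = ∑ k ∈ Finset.range j,
      (viete l k * horner l r (j + i - 1 - k) - viete l (j + i - 1 - k) * horner l r k) := by
  induction j with
  | zero => intro i; simp [horner]
  | succ j ih =>
    intro i
    have h := ih (i + 1)
    rw [show j + (i + 1) - 1 = j + i by omega] at h
    rw [Finset.sum_range_succ, show j + 1 + i - 1 = j + i by omega, ← h, Nat.add_sub_cancel_left]
    simp only [horner]
    ring

lemma HasCoeffDerivAt.finset_prod {ι : Type} [DecidableEq ι] (S : Finset ι)
    {F : ι → ℝ → PowerSeries ℝ} {F' : ι → PowerSeries ℝ} {y : ℝ}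
    (h : ∀ r ∈ S, HasCoeffDerivAt (F r) (F' r) y) :
    HasCoeffDerivAt (fun z => ∏ r ∈ S, F r z) (∑ r ∈ S, F' r * ∏ s ∈ S.erase r, F s y) y := by
  induction S using Finset.induction_on with
  | empty => simpa using HasCoeffDerivAt.const 1 y
  | insert b S hb ih =>
    simp only [Finset.prod_insert hb]
    refine ((h b (Finset.mem_insert_self b S)).mul
      (ih fun r hr => h r (Finset.mem_insert_of_mem hr))).congr_deriv ?_
    rw [Finset.sum_insert hb, Finset.erase_insert hb, Finset.mul_sum]
    congr 1
    refine Finset.sum_congr rfl fun r hr => ?_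
    have hne : b ≠ r := fun h => hb (h ▸ hr)
    rw [Finset.erase_insert_of_ne hne,
      Finset.prod_insert fun hm => hb (Finset.mem_of_mem_erase hm)]
    ring

/-- The chain rule with `∂q_j/∂λ_r = -ρ_j(λ_r)`. -/
lemma hasDerivAt_viete {n : ℕ} {l : ℝ → Fin n → ℝ} {l' : Fin n → ℝ} {y : ℝ}
    (hl : ∀ r, HasDerivAt (fun z => l z r) (l' r) y) (j : ℕ) :
    HasDerivAt (fun z => viete (l z) j) (-∑ r, horner (l y) r j * l' r) y := by
  rcases lt_or_ge n j with hj | hj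
  · simp only [viete_of_lt _ hj, horner_of_lt _ _ hj, zero_mul, Finset.sum_const_zero, neg_zero]
    exact hasDerivAt_const y 0
  have h1 : ∀ r ∈ (Finset.univ : Finset (Fin n)), HasCoeffDerivAt
      (fun z => ((Polynomial.X - Polynomial.C (l z r) : Polynomial ℝ) : PowerSeries ℝ))
      ((-Polynomial.C (l' r) : Polynomial ℝ) : PowerSeries ℝ) y := by
    intro r _ k
    simp only [Polynomial.coeff_coe, Polynomial.coeff_sub, Polynomial.coeff_neg,
      Polynomial.coeff_C]
    split_ifs with hk
    · exact (hl r).const_sub _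
    · simpa using hasDerivAt_const y ((Polynomial.X : Polynomial ℝ).coeff k)
  have h2 := HasCoeffDerivAt.finset_prod Finset.univ h1 (n - j)
  have e : ∀ S : Finset (Fin n), ∀ z, (∏ s ∈ S,
      ((Polynomial.X - Polynomial.C (l z s) : Polynomial ℝ) : PowerSeries ℝ))
        = ((∏ s ∈ S, (Polynomial.X - Polynomial.C (l z s)) : Polynomial ℝ) : PowerSeries ℝ) :=
    fun S z => by
      rw [← Polynomial.coeToPowerSeries.ringHom_apply, map_prod]
      simp only [Polynomial.coeToPowerSeries.ringHom_apply]
  simp only [e, ← Polynomial.coe_mul, Polynomial.coeff_coe, map_sum] at h2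
  refine (h2.congr_of_eventuallyEq (Eventually.of_forall fun z => ?_)).congr_deriv ?_
  · exact ((coeff_rootPoly (l z) (Nat.sub_le n j)).trans
      (by rw [Nat.sub_sub_self hj])).symm
  · rw [← Finset.sum_neg_distrib]
    refine Finset.sum_congr rfl fun r _ => ?_
    rw [neg_mul, Polynomial.coeff_neg, Polynomial.coeff_C_mul, ← coeff_cofactor (l y) r j hj,
      cofactor, mul_comm]

lemma pderiv_viete {n : ℕ} {ι : Type} [Fintype ι] [DecidableEq ι] {lam : Fin n → (ι → ℝ) → ℝ}
    {t : ι → ℝ} (hl : ∀ r, DifferentiableAt ℝ (lam r) t) (i : ι) (j : ℕ) :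
    pderiv i (fun t => viete (fun r => lam r t) j) t
      = -∑ r, horner (fun s => lam s t) r j * pderiv i (lam r) t := by
  have := hasDerivAt_viete (l := fun y r => lam r (Function.update t i y))
    (fun r => hasDerivAt_pderiv (hl r) i) j
  rw [Function.update_eq_self] at this
  exact this.deriv

/-- If each root moves with `t_k`-velocity `ρ_k(λ_r) λ_{r,x}`, then the Viète coordinates move along
the `k`-th Killing field. -/
lemma pderiv_viete_eq_sum {n : ℕ} {ι : Type} [Fintype ι] [DecidableEq ι]
    {lam : Fin n → (ι → ℝ) → ℝ} {t : ι → ℝ} (hl : ∀ r, DifferentiableAt ℝ (lam r) t)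
    {x i : ι} {k : ℕ}
    (h : ∀ r, pderiv i (lam r) t = horner (fun s => lam s t) r k * pderiv x (lam r) t) (j : ℕ) :
    pderiv i (fun t => viete (fun r => lam r t) j) t = ∑ m ∈ Finset.range j,
      (viete (fun r => lam r t) m
          * pderiv x (fun t => viete (fun r => lam r t) (j + k - 1 - m)) t
        - viete (fun r => lam r t) (j + k - 1 - m)
          * pderiv x (fun t => viete (fun r => lam r t) m) t) := by
  simp only [pderiv_viete hl, h]
  have e : ∀ r, horner (fun s => lam s t) r j
        * (horner (fun s => lam s t) r k * pderiv x (lam r) t)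
      = ∑ m ∈ Finset.range j, (viete (fun r => lam r t) m
          * (horner (fun s => lam s t) r (j + k - 1 - m) * pderiv x (lam r) t)
        - viete (fun r => lam r t) (j + k - 1 - m)
          * (horner (fun s => lam s t) r m * pderiv x (lam r) t)) := fun r => by
    rw [mul_left_comm, ← mul_assoc, horner_mul_horner, Finset.sum_mul]
    exact Finset.sum_congr rfl fun m _ => by ring
  simp_rw [e]
  rw [Finset.sum_comm, ← Finset.sum_neg_distrib]
  refine Finset.sum_congr rfl fun m _ => ?_
  rw [Finset.sum_sub_distrib, ← Finset.mul_sum, ← Finset.mul_sum]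
  ring

/-! ### The polynomial identity behind the elimination -/

/-- A polynomial with a double zero at each of the distinct points `λ_r` is divisible by `p²`. -/
lemma rootPoly_sq_dvd {n : ℕ} {l : Fin n → ℝ} (hl : Function.Injective l) {W : Polynomial ℝ}
    (h0 : ∀ r, W.eval (l r) = 0) (h1 : ∀ r, (Polynomial.derivative W).eval (l r) = 0) :
    rootPoly l ^ 2 ∣ W := by
  rw [rootPoly, ← Finset.prod_pow]
  refine Finset.prod_dvd_of_coprime (fun r _ s _ hrs => ?_) fun r _ => ?_
  · exact (Polynomial.pairwise_coprime_X_sub_C hl hrs).pow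
  · obtain ⟨V, hV⟩ := Polynomial.dvd_iff_isRoot.mpr (h0 r)
    have h2 := h1 r
    rw [hV] at h2
    simp only [Polynomial.derivative_mul, Polynomial.derivative_sub, Polynomial.derivative_X,
      Polynomial.derivative_C, sub_zero, one_mul, Polynomial.eval_add, Polynomial.eval_mul,
      Polynomial.eval_sub, Polynomial.eval_X, Polynomial.eval_C, sub_self, zero_mul,
      add_zero] at h2
    obtain ⟨V', hV'⟩ := Polynomial.dvd_iff_isRoot.mpr h2
    exact ⟨V', by rw [hV, hV']; ring⟩

/-- The polynomial `∑_{1 ≤ j ≤ n} v_j z^{n-j}`, whose power series is `highTangent n v`. -/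
def tangentPoly (n : ℕ) (v : ℕ → ℝ) : Polynomial ℝ :=
  ∑ i ∈ Finset.Icc 1 n, Polynomial.C (v i) * Polynomial.X ^ (n - i)

lemma coe_tangentPoly (n : ℕ) (v : ℕ → ℝ) :
    (tangentPoly n v : PowerSeries ℝ) = highTangent n v := by
  rw [highTangent_eq_sum, tangentPoly]
  rw [← Polynomial.coeToPowerSeries.ringHom_apply, map_sum]
  simp

lemma natDegree_tangentPoly_le (n : ℕ) (v : ℕ → ℝ) : (tangentPoly n v).natDegree ≤ n - 1 :=
  Polynomial.natDegree_sum_le_of_forall_le _ _ fun i hi =>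
    (Polynomial.natDegree_C_mul_X_pow_le _ _).trans (by rw [Finset.mem_Icc] at hi; omega)

lemma coe_rootPoly {n : ℕ} (l : Fin n → ℝ) :
    (rootPoly l : PowerSeries ℝ) = highSeries n (viete l) := by
  ext k
  rw [Polynomial.coeff_coe, highSeries, PowerSeries.coeff_mk]
  split_ifs with hk
  · rw [coeff_rootPoly l hk, coord]
    split_ifs with h1 h2
    · rw [h1, viete_zero]
    · rfl
    · omega
  · exact Polynomial.coeff_eq_zero_of_natDegree_lt (by rw [natDegree_rootPoly]; omega)

lemma coe_reflect_rootPoly {n : ℕ} (l : Fin n → ℝ) :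
    (Polynomial.reflect n (rootPoly l) : PowerSeries ℝ) = lowSeries n (viete l) := by
  ext k
  rw [Polynomial.coeff_coe, Polynomial.coeff_reflect, lowSeries, PowerSeries.coeff_mk]
  rcases le_or_gt k n with hk | hk
  · rw [Polynomial.revAt_le hk, coeff_rootPoly l (Nat.sub_le n k), Nat.sub_sub_self hk, coord]
    split_ifs with h1
    · rw [h1, viete_zero]
    · rfl
  · rw [Polynomial.revAt_eq_self_of_lt hk, coord_of_lt hk]
    exact Polynomial.coeff_eq_zero_of_natDegree_lt (by rwa [natDegree_rootPoly])

lemma coe_reflect_tangentPoly (n : ℕ) (v : ℕ → ℝ) :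
    (Polynomial.reflect n (tangentPoly n v) : PowerSeries ℝ) = lowTangent n v := by
  ext k
  have hc : ∀ m, (tangentPoly n v).coeff m = if m < n then v (n - m) else 0 := fun m => by
    rw [← Polynomial.coeff_coe, coe_tangentPoly, highTangent, PowerSeries.coeff_mk]
  rw [Polynomial.coeff_coe, Polynomial.coeff_reflect, hc, lowTangent, PowerSeries.coeff_mk]
  rcases le_or_gt k n with hk | hk
  · rw [Polynomial.revAt_le hk, Nat.sub_sub_self hk]
    exact if_congr (by omega) rfl rfl
  · rw [Polynomial.revAt_eq_self_of_lt hk, if_neg (by omega), if_neg (by omega)]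

/-- If `1 + A + z^N (2 p p₂ - p₁²)` has a double zero at every root of `p`, where `deg A < 2n`, then
it equals `-B p²` with the drift `B` of `p, p₁, p₂`: comparing degrees, `B` has degree less than
`N`, and the reflected identity modulo `w^{N+1}` does not see `1 + A`. -/
lemma one_add_drift_mul {n N : ℕ} (hn : 1 ≤ n) (hN : 1 ≤ N) {l : Fin n → ℝ}
    (hl : Function.Injective l) (v v₂ : ℕ → ℝ) {A : Polynomial ℝ} (hA : A.natDegree < 2 * n)
    (h0 : ∀ r, (1 + A + Polynomial.X ^ N * (2 * rootPoly l * tangentPoly n v₂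
      - tangentPoly n v ^ 2)).eval (l r) = 0)
    (h1 : ∀ r, (Polynomial.derivative (1 + A + Polynomial.X ^ N * (2 * rootPoly l
      * tangentPoly n v₂ - tangentPoly n v ^ 2))).eval (l r) = 0) :
    residual N (drift N (schwarzian (lowSeries n (viete l)) (lowTangent n v) (lowTangent n v₂)))
      (highSeries n (viete l)) (highTangent n v) (highTangent n v₂) = -(A : PowerSeries ℝ) := by
  obtain ⟨B, hB⟩ := rootPoly_sq_dvd hl h0 h1
  have hp := natDegree_rootPoly l
  have hv := natDegree_tangentPoly_le n v
  have hv₂ := natDegree_tangentPoly_le n v₂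
  have hK : (2 * rootPoly l * tangentPoly n v₂ - tangentPoly n v ^ 2).natDegree ≤ 2 * n - 1 := by
    refine (Polynomial.natDegree_sub_le _ _).trans (max_le ?_ ?_)
    · have h2 : (2 * rootPoly l).natDegree ≤ n := by
        refine Polynomial.natDegree_mul_le.trans ?_
        rw [hp, Polynomial.natDegree_ofNat, zero_add]
      exact Polynomial.natDegree_mul_le.trans (by omega)
    · exact Polynomial.natDegree_pow_le.trans (by omega)
  have hA1 : (1 + A).natDegree < 2 * n := by
    refine lt_of_le_of_lt (Polynomial.natDegree_add_le _ _) (max_lt ?_ hA)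
    rw [Polynomial.natDegree_one]; omega
  have hXK : (Polynomial.X ^ N * (2 * rootPoly l * tangentPoly n v₂
      - tangentPoly n v ^ 2)).natDegree ≤ N + (2 * n - 1) := by
    refine Polynomial.natDegree_mul_le.trans ?_
    rw [Polynomial.natDegree_X_pow]
    omega
  have hBdeg : B.natDegree < N := by
    rcases eq_or_ne B 0 with rfl | hB0
    · rw [Polynomial.natDegree_zero]; omega
    have h2 : (rootPoly l ^ 2 * B).natDegree ≤ N + (2 * n - 1) := by
      rw [← hB]
      exact (Polynomial.natDegree_add_le _ _).trans (max_le (by omega) hXK)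
    rw [((monic_rootPoly l).pow 2).natDegree_mul' hB0, (monic_rootPoly l).natDegree_pow, hp] at h2
    omega
  have hrefl : Polynomial.reflect (N + 2 * n) (1 + A)
        + (2 * Polynomial.reflect n (rootPoly l) * Polynomial.reflect n (tangentPoly n v₂)
          - Polynomial.reflect n (tangentPoly n v) ^ 2)
      = Polynomial.reflect n (rootPoly l) ^ 2 * Polynomial.reflect N B := by
    have h3 := congrArg (Polynomial.reflect (N + 2 * n)) hB
    rw [Polynomial.reflect_add, Polynomial.reflect_mul _ _ (Polynomial.natDegree_X_pow_le N)
      (hK.trans (Nat.sub_le _ _)), add_comm N (2 * n), Polynomial.reflect_mul _ _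
        (by rw [(monic_rootPoly l).natDegree_pow, hp]) hBdeg.le, two_mul n, Polynomial.reflect_sub,
      sq, sq, Polynomial.reflect_mul _ _ hp.le hp.le,
      Polynomial.reflect_mul _ _ (hv.trans (Nat.sub_le _ _)) (hv.trans (Nat.sub_le _ _)),
      mul_assoc 2, ← map_ofNat Polynomial.C 2, Polynomial.reflect_C_mul,
      Polynomial.reflect_mul _ _ hp.le (hv₂.trans (Nat.sub_le _ _))] at h3
    have h4 : Polynomial.reflect N (Polynomial.X ^ N : Polynomial ℝ) = 1 := by
      rw [Polynomial.reflect_monomial]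
      simp
    rw [h4, one_mul] at h3
    rw [add_comm N, two_mul n, sq, sq, mul_assoc 2, ← map_ofNat Polynomial.C 2]
    exact h3
  have htwo : ((2 : Polynomial ℝ) : PowerSeries ℝ) = 2 :=
    map_ofNat Polynomial.coeToPowerSeries.ringHom 2
  have hcoe := congrArg (fun F : Polynomial ℝ => (F : PowerSeries ℝ)) hrefl
  have hcoe' : (Polynomial.reflect (N + 2 * n) (1 + A) : PowerSeries ℝ)
        + (2 * lowSeries n (viete l) * lowTangent n v₂ - lowTangent n v ^ 2)
      = lowSeries n (viete l) ^ 2 * (Polynomial.reflect N B : Polynomial ℝ) := by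
    simpa [htwo, coe_reflect_rootPoly, coe_reflect_tangentPoly] using hcoe
  have hdrift : drift N (schwarzian (lowSeries n (viete l)) (lowTangent n v) (lowTangent n v₂))
      = -(B : PowerSeries ℝ) := by
    rw [drift_schwarzian_eq (R := -((Polynomial.reflect N B : Polynomial ℝ) : PowerSeries ℝ))
      (by rw [constantCoeff_lowSeries]; exact one_ne_zero) (by rw [sub_self]; exact dvd_zero _)
      (by rw [sub_self]; exact dvd_zero _) (by rw [sub_self]; exact dvd_zero _)]
    · ext k
      rw [drift, PowerSeries.coeff_mk, map_neg, map_neg, Polynomial.coeff_coe,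
        Polynomial.coeff_coe]
      split_ifs with hk
      · rw [Polynomial.coeff_reflect, Polynomial.revAt_le (Nat.sub_le _ _),
          Nat.sub_sub_self hk.le]
      · rw [Polynomial.coeff_eq_zero_of_natDegree_lt (by omega), neg_zero]
    · have e : 2 * lowSeries n (viete l) * lowTangent n v₂ - lowTangent n v ^ 2
          + -((Polynomial.reflect N B : Polynomial ℝ) : PowerSeries ℝ) * lowSeries n (viete l) ^ 2
          = -(Polynomial.reflect (N + 2 * n) (1 + A) : PowerSeries ℝ) := by
        linear_combination hcoe'
      rw [e]
      refine PowerSeries.X_pow_dvd_iff.mpr fun m hm => ?_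
      rw [map_neg, Polynomial.coeff_coe, Polynomial.coeff_reflect,
        Polynomial.revAt_le (by omega), Polynomial.coeff_eq_zero_of_natDegree_lt (by omega),
        neg_zero]
  have hB' : (1 : PowerSeries ℝ) + (A : PowerSeries ℝ) + PowerSeries.X ^ N
        * (2 * highSeries n (viete l) * highTangent n v₂ - highTangent n v ^ 2)
      = highSeries n (viete l) ^ 2 * (B : PowerSeries ℝ) := by
    have := congrArg (fun F : Polynomial ℝ => (F : PowerSeries ℝ)) hB
    simpa [htwo, coe_rootPoly, coe_tangentPoly] using this
  rw [hdrift, residual]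
  linear_combination hB'

/-! ### Existence of the elimination -/

lemma eval_tangentPoly (n : ℕ) (v : ℕ → ℝ) (y : ℝ) :
    (tangentPoly n v).eval y = ∑ i ∈ Finset.range n, v (i + 1) * y ^ (n - 1 - i) := by
  have h : Finset.Icc 1 n = Finset.Ico (0 + 1) (n + 1) := by
    rw [zero_add]; rfl
  rw [tangentPoly, Polynomial.eval_finsetSum, h,
    ← Finset.sum_Ico_add' (fun i => Polynomial.eval y (Polynomial.C (v i) * Polynomial.X ^ (n - i)))
      0 n 1, Finset.range_eq_Ico]
  refine Finset.sum_congr rfl fun i _ => ?_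
  simp [show n - (i + 1) = n - 1 - i by omega]

lemma hasDerivAt_eval_tangentPoly {n : ℕ} {v : ℝ → ℕ → ℝ} {v' : ℕ → ℝ} {ℓ : ℝ → ℝ} {ℓ' y : ℝ}
    (hv : ∀ i ∈ Finset.Icc 1 n, HasDerivAt (fun z => v z i) (v' i) y) (hℓ : HasDerivAt ℓ ℓ' y) :
    HasDerivAt (fun z => (tangentPoly n (v z)).eval (ℓ z))
      ((tangentPoly n v').eval (ℓ y)
        + (Polynomial.derivative (tangentPoly n (v y))).eval (ℓ y) * ℓ') y := by
  simp only [tangentPoly, Polynomial.eval_finsetSum, Polynomial.derivative_sum, Finset.sum_mul,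
    ← Finset.sum_add_distrib, Polynomial.eval_mul, Polynomial.eval_C, Polynomial.eval_pow,
    Polynomial.eval_X, Polynomial.derivative_C_mul_X_pow]
  refine HasDerivAt.fun_sum fun i hi => ((hv i hi).mul (hℓ.fun_pow (n - i))).congr_deriv ?_
  ring

/-- Differentiating `p(λ_r) = 0`: the tangent polynomial of the moving `p` takes the value
`-p'(λ_r) λ_{r,x}` at `λ_r`. -/
lemma eval_tangentPoly_velocity {n : ℕ} {ι : Type} [Fintype ι] [DecidableEq ι]
    {lam : Fin n → (ι → ℝ) → ℝ} {t : ι → ℝ} (hl : ∀ r, DifferentiableAt ℝ (lam r) t) (x : ι)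
    (r : Fin n) :
    (tangentPoly n (velocity x (fun j t => viete (fun s => lam s t) j) t)).eval (lam r t)
      = -((cofactor (fun s => lam s t) r).eval (lam r t) * pderiv x (lam r) t) := by
  have h : ∑ s, (cofactor (fun s => lam s t) s).eval (lam r t) * pderiv x (lam s) t
      = (cofactor (fun s => lam s t) r).eval (lam r t) * pderiv x (lam r) t :=
    Finset.sum_eq_single r (fun s _ hs => by
      rw [eval_cofactor_of_ne (fun s => lam s t) hs.symm, zero_mul])
      (fun hr => absurd (Finset.mem_univ r) hr)
  rw [← h, eval_tangentPoly]
  simp only [velocity, pderiv_viete hl, eval_cofactor, Finset.sum_mul, neg_mul,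
    Finset.sum_neg_distrib]
  rw [Finset.sum_comm]
  refine congrArg Neg.neg (Finset.sum_congr rfl fun s _ => Finset.sum_congr rfl fun i _ => ?_)
  ring

/-- The polynomial `4 z^{n-β} ∑_j a_j z^{n-j}`. -/
def spectralPoly (n β : ℕ) (a : Fin n → ℝ) : Polynomial ℝ :=
  Polynomial.X ^ (n - β) *
    ∑ j : Fin n, Polynomial.C (4 * a j) * Polynomial.X ^ (n - 1 - (j : ℕ))

lemma natDegree_spectralPoly_lt {n : ℕ} (hn : 1 ≤ n) (β : ℕ) (a : Fin n → ℝ) :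
    (spectralPoly n β a).natDegree < 2 * n := by
  have h : (∑ j : Fin n, Polynomial.C (4 * a j)
      * Polynomial.X ^ (n - 1 - (j : ℕ)) : Polynomial ℝ).natDegree ≤ n - 1 :=
    Polynomial.natDegree_sum_le_of_forall_le _ _ fun j _ =>
      (Polynomial.natDegree_C_mul_X_pow_le _ _).trans (Nat.sub_le _ _)
  refine lt_of_le_of_lt Polynomial.natDegree_mul_le ?_
  rw [Polynomial.natDegree_X_pow]
  omega

lemma four_mul_radicand {n N β : ℕ} (hβ : β ≤ n) (a : Fin n → ℝ) {y : ℝ} (hy : y ≠ 0) :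
    4 * y ^ N * radicand n N β a y = 1 + (spectralPoly n β a).eval y := by
  have h1 : y ^ ((n : ℤ) - β - N) = y ^ (n - β) / y ^ N := by
    rw [zpow_sub₀ hy, zpow_natCast, ← Nat.cast_sub hβ, zpow_natCast]
  have h2 : y ^ ((β : ℤ) - n) = (y ^ (n - β))⁻¹ := by
    rw [← zpow_natCast, Nat.cast_sub hβ, ← zpow_neg, neg_sub]
  have h3 : (∑ j : Fin n, Polynomial.C (4 * a j)
      * Polynomial.X ^ (n - 1 - (j : ℕ)) : Polynomial ℝ).eval y
        = 4 * ∑ j : Fin n, a j * y ^ (n - 1 - (j : ℕ)) := by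
    simp [Polynomial.eval_finsetSum, Finset.mul_sum, mul_assoc]
  rw [radicand, spectralPoly, h1, h2, Polynomial.eval_mul, h3, Polynomial.eval_pow,
    Polynomial.eval_X]
  have h4 : y ^ N ≠ 0 := pow_ne_zero _ hy
  have h5 : y ^ (n - β) ≠ 0 := pow_ne_zero _ hy
  field_simp
  ring

lemma contDiffOn_viete {n : ℕ} {ι : Type} [Fintype ι] {U : Set (ι → ℝ)}
    {lam : Fin n → (ι → ℝ) → ℝ} (hl : ∀ r, ContDiffOn ℝ ∞ (lam r) U) (j : ℕ) :
    ContDiffOn ℝ ∞ (fun t => viete (fun r => lam r t) j) U :=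
  contDiffOn_const.mul (ContDiffOn.sum fun _ _ => contDiffOn_prod fun r _ => hl r)

/-- The roots `λ_r` are smooth and distinct on `U`, lie where the radicand is positive, and satisfy
the squared Dubrovin equations `(p'(λ_r) λ_{r,x})² = 4 radicand (λ_r)`. -/
structure IsDubrovinSolution {n : ℕ} {ι : Type} [Fintype ι] [DecidableEq ι] (N β : ℕ)
    (a : Fin n → ℝ) (x : ι) (U : Set (ι → ℝ)) (lam : Fin n → (ι → ℝ) → ℝ) : Prop where
  smooth : ∀ r, ContDiffOn ℝ ∞ (lam r) U
  injective : ∀ t ∈ U, Function.Injective fun r => lam r t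
  ne_zero : ∀ t ∈ U, ∀ r, lam r t ≠ 0
  radicand_pos : ∀ t ∈ U, ∀ r, 0 < radicand n N β a (lam r t)
  sq_eq : ∀ t ∈ U, ∀ r, ((cofactor (fun s => lam s t) r).eval (lam r t) * pderiv x (lam r) t) ^ 2
    = 4 * radicand n N β a (lam r t)

/-- For a solution of the Dubrovin equations `1 + 4 z^{n-β} a(z) + z^N (2 p p_xx - p_x²)` has a
double zero at every `λ_r`, by differentiating `λ_r^N p_x(λ_r)² = 1 + 4 λ_r^{n-β} a(λ_r)` along `x`.
Hence `1 + B p² + z^N (2 p p_xx - p_x²) = -4 z^{n-β} a(z)`. -/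
lemma residual_viete {n N β : ℕ} (hN : 1 ≤ N) (hβ : β < n) (a : Fin n → ℝ) {ι : Type}
    [Fintype ι] [DecidableEq ι] {U : Set (ι → ℝ)} (hU : IsOpen U) {lam : Fin n → (ι → ℝ) → ℝ}
    {x : ι} (h : IsDubrovinSolution N β a x U lam) {t : ι → ℝ} (ht : t ∈ U) :
    residual N (driftAt x N n (fun j t => viete (fun s => lam s t) j) t)
      (highSeries n fun j => viete (fun s => lam s t) j)
      (highTangent n (velocity x (fun j t => viete (fun s => lam s t) j) t))
      (highTangent n (acceleration x (fun j t => viete (fun s => lam s t) j) t))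
        = -(spectralPoly n β a : PowerSeries ℝ) := by
  have hu := contDiffOn_viete h.smooth
  obtain ⟨hl, hinj, hne, hpos, hdub⟩ := h
  have hd : ∀ t ∈ U, ∀ r, DifferentiableAt ℝ (lam r) t := fun t ht r =>
    differentiableAt_of_contDiffOn hU (hl r) ht
  have hsq : ∀ t ∈ U, ∀ r, lam r t ^ N *
      (tangentPoly n (velocity x (fun j t => viete (fun s => lam s t) j) t)).eval (lam r t) ^ 2
        = 1 + (spectralPoly n β a).eval (lam r t) := fun t ht r => by
    rw [eval_tangentPoly_velocity (hd t ht), neg_sq, hdub t ht,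
      ← four_mul_radicand hβ.le a (hne t ht r)]
    ring
  refine one_add_drift_mul (by omega) hN (hinj t ht) _ _
    (natDegree_spectralPoly_lt (by omega) β a) (fun r => ?_) fun r => ?_
  · have h1 := hsq t ht r
    have h2 := eval_rootPoly (fun s => lam s t) r
    simp only [Polynomial.eval_add, Polynomial.eval_one, Polynomial.eval_mul, Polynomial.eval_sub,
      Polynomial.eval_pow, Polynomial.eval_X, h2]
    linear_combination -h1
  · have hlx : pderiv x (lam r) t ≠ 0 := fun h0 => by
      have h1 := hdub t ht r
      have h2 := hpos t ht r
      rw [h0] at h1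
      linarith
    -- The derivative of `λ_r^N p_x(λ_r)² = 1 + 4 λ_r^{n-β} a(λ_r)` along `x`.
    have hdiff : N * lam r t ^ (N - 1) * pderiv x (lam r) t *
          (tangentPoly n (velocity x (fun j t => viete (fun s => lam s t) j) t)).eval (lam r t) ^ 2
        + lam r t ^ N * (2 *
          (tangentPoly n (velocity x (fun j t => viete (fun s => lam s t) j) t)).eval (lam r t) *
          ((tangentPoly n (acceleration x (fun j t => viete (fun s => lam s t) j) t)).eval
              (lam r t)
            + (Polynomial.derivative (tangentPoly n (velocity x
                (fun j t => viete (fun s => lam s t) j) t))).eval (lam r t)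
              * pderiv x (lam r) t))
        = (Polynomial.derivative (spectralPoly n β a)).eval (lam r t) * pderiv x (lam r) t := by
      have h1 := hasDerivAt_pderiv (hd t ht r) x
      have h2 := hasDerivAt_eval_tangentPoly (n := n)
        (v := fun z => velocity x (fun j t => viete (fun s => lam s t) j) (Function.update t x z))
        (fun i _ => hasDerivAt_pderiv (differentiableAt_of_contDiffOn hU
          (contDiffOn_pderiv hU (hu i) x) ht) x) h1
      have h3 := ((spectralPoly n β a).hasDerivAt (lam r (Function.update t x (t x)))).comp (t x) h1
      have h4 := ((h1.fun_pow N).mul (h2.fun_pow 2)).unique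
        ((h3.const_add 1).congr_of_eventuallyEq (by
          filter_upwards [eventually_update_mem hU ht x] with z hz
          exact hsq _ hz r))
      rw [Function.update_eq_self] at h4
      refine Eq.trans ?_ h4
      unfold acceleration
      push_cast
      ring
    have h1 := eval_rootPoly (fun s => lam s t) r
    have h2 := eval_derivative_rootPoly (fun s => lam s t) r
    have h3 := eval_tangentPoly_velocity (hd t ht) x r
    refine (mul_eq_zero.mp ?_).resolve_right hlx
    simp only [Polynomial.derivative_add, Polynomial.derivative_one, Polynomial.derivative_mul,
      Polynomial.derivative_sub, Polynomial.derivative_X, Polynomial.derivative_pow,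
      Polynomial.derivative_ofNat, Polynomial.eval_add,
      Polynomial.eval_mul, Polynomial.eval_sub, Polynomial.eval_pow, Polynomial.eval_X,
      Polynomial.eval_one, Polynomial.eval_ofNat, Polynomial.eval_natCast, Polynomial.eval_zero,
      h1, h2, map_natCast]
    push_cast
    linear_combination -hdiff + 2 * lam r t ^ N *
      (tangentPoly n (acceleration x (fun j t => viete (fun s => lam s t) j) t)).eval (lam r t) * h3

lemma residual_dvd_of_dvd {N s : ℕ} {B P P₁ P₂ K K₁ K₂ : PowerSeries ℝ}
    (h : PowerSeries.X ^ s ∣ P - K) (h₁ : PowerSeries.X ^ s ∣ P₁ - K₁)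
    (h₂ : PowerSeries.X ^ s ∣ P₂ - K₂) (hK : PowerSeries.X ^ s ∣ residual N B K K₁ K₂) :
    PowerSeries.X ^ s ∣ residual N B P P₁ P₂ := by
  have e : residual N B P P₁ P₂ = residual N B K K₁ K₂
      + ((P - K) * (B * (P + K) + 2 * PowerSeries.X ^ N * P₂)
        + (P₂ - K₂) * (2 * PowerSeries.X ^ N * K)
        - (P₁ - K₁) * (PowerSeries.X ^ N * (P₁ + K₁))) := by
    rw [residual, residual]; ring
  rw [e]
  exact dvd_add hK (dvd_sub (dvd_add (h.mul_right _) (h₂.mul_right _)) (h₁.mul_right _))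

/-- The Viète coordinates `q_n, q_{n-1}, …, q_{n+1-s}` are the eliminated variables
`q_{N+s}, …, q_{N+1}` that belong to `q_1, …, q_N`. -/
lemma isElimination_viete {n N β s : ℕ} (hN : 1 ≤ N) (hβ : β < n) (hs : s ≤ n - β)
    (a : Fin n → ℝ) {ι : Type} [Fintype ι] [DecidableEq ι] {U : Set (ι → ℝ)} (hU : IsOpen U)
    {lam : Fin n → (ι → ℝ) → ℝ} {x : ι} (h : IsDubrovinSolution N β a x U lam) {η : ℝ}
    (hη : ∀ t ∈ U, 0 < η * viete (fun r => lam r t) n) :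
    IsElimination x N s η U (fun j t => viete (fun r => lam r t) j)
      (fun b t => viete (fun r => lam r t) (n + 1 - b)) := by
  have hu := contDiffOn_viete h.smooth
  refine ⟨fun b _ => hu _, fun t ht => by simpa using hη t ht, ?_⟩
  suffices H : ∀ t ∈ U, ∀ i ∈ Finset.Icc 1 s, eulerLagrange x (N + s) (s : ℤ)
      (-((N + s : ℕ) : ℤ)) i (assemble N s (fun j t => viete (fun r => lam r t) j)
        (fun b t => viete (fun r => lam r t) (n + 1 - b))) t = 0 from
    fun i hi t ht => H t ht i hi
  intro t ht
  rcases Nat.eq_zero_or_pos s with rfl | hs0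
  · simp
  refine (eulerLagrange_eq_zero_iff hU x (contDiffOn_assemble (fun j _ => hu j)
    fun b _ => hu _) (by omega) (fun t ht h0 => ?_) ht).mpr ?_
  · rw [assemble_of_gt (by omega), show N + s + 1 - (N + s) = 1 by omega, Nat.add_sub_cancel] at h0
    exact (hη t ht).ne' (by rw [h0, mul_zero])
  have hzero : ∀ j, n < j → (fun t => viete (fun r => lam r t) j) = fun _ => (0 : ℝ) :=
    fun j hj => funext fun t => viete_of_lt _ hj
  have hpz : ∀ t : ι → ℝ, pderiv x (fun _ : ι → ℝ => (0 : ℝ)) t = 0 := fun t => by simp [pderiv]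
  have hpz' : pderiv x (fun _ : ι → ℝ => (0 : ℝ)) = fun _ => 0 := funext hpz
  have hdrift : driftAt x N (N + s) (assemble N s (fun j t => viete (fun r => lam r t) j)
        (fun b t => viete (fun r => lam r t) (n + 1 - b))) t
      = driftAt x N n (fun j t => viete (fun r => lam r t) j) t := by
    have h0 : ∀ (m : ℕ) (q : ℕ → ℝ), PowerSeries.constantCoeff (lowSeries m q) ≠ 0 :=
      fun m q => by rw [constantCoeff_lowSeries]; exact one_ne_zero
    refine drift_schwarzian_eq (h0 _ _) ?_ ?_ ?_
      (by rw [two_mul_add_schwarzian (h0 _ _)]; exact dvd_zero _)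
    · refine PowerSeries.X_pow_dvd_iff.mpr fun m hm => ?_
      rw [map_sub, lowSeries, lowSeries, PowerSeries.coeff_mk, PowerSeries.coeff_mk, sub_eq_zero,
        coord, coord, assemble_of_le (by omega), if_pos (show m ≤ N + s by omega)]
      split_ifs with h1 h2
      · rfl
      · rfl
      · exact viete_of_lt _ (by omega)
    · refine PowerSeries.X_pow_dvd_iff.mpr fun m hm => ?_
      rw [map_sub, lowTangent, lowTangent, PowerSeries.coeff_mk, PowerSeries.coeff_mk,
        sub_eq_zero, velocity, velocity, assemble_of_le (by omega)]
      rcases Nat.eq_zero_or_pos m with rfl | hm0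
      · simp
      · rw [if_pos (by omega)]
        split_ifs with h2
        · rfl
        · rw [hzero m (by omega), hpz]
    · refine PowerSeries.X_pow_dvd_iff.mpr fun m hm => ?_
      rw [map_sub, lowTangent, lowTangent, PowerSeries.coeff_mk, PowerSeries.coeff_mk,
        sub_eq_zero, acceleration, acceleration, assemble_of_le (by omega)]
      rcases Nat.eq_zero_or_pos m with rfl | hm0
      · simp
      · rw [if_pos (by omega)]
        split_ifs with h2
        · rfl
        · rw [hzero m (by omega), hpz', hpz]
  rw [hdrift]
  refine residual_dvd_of_dvd (K := highSeries n fun j => viete (fun s => lam s t) j)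
    (K₁ := highTangent n (velocity x (fun j t => viete (fun s => lam s t) j) t))
    (K₂ := highTangent n (acceleration x (fun j t => viete (fun s => lam s t) j) t))
    ?_ ?_ ?_ ?_
  · refine PowerSeries.X_pow_dvd_iff.mpr fun m hm => ?_
    rw [map_sub, coeff_highSeries_assemble hm, highSeries, PowerSeries.coeff_mk,
      if_pos (by omega), coord, if_neg (by omega), if_pos (by omega), sub_eq_zero,
      show n + 1 - (m + 1) = n - m by omega]
  · refine PowerSeries.X_pow_dvd_iff.mpr fun m hm => ?_
    rw [map_sub, coeff_highTangent_assemble x hm, highTangent, PowerSeries.coeff_mk,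
      if_pos (by omega), velocity, sub_eq_zero, show n + 1 - (m + 1) = n - m by omega]
  · refine PowerSeries.X_pow_dvd_iff.mpr fun m hm => ?_
    rw [map_sub, coeff_highTangent_acceleration_assemble x hm, highTangent, PowerSeries.coeff_mk,
      if_pos (by omega), acceleration, sub_eq_zero, show n + 1 - (m + 1) = n - m by omega]
  · rw [residual_viete hN hβ a hU h ht]
    refine PowerSeries.X_pow_dvd_iff.mpr fun m hm => ?_
    rw [map_neg, Polynomial.coeff_coe, spectralPoly, Polynomial.coeff_X_pow_mul',
      if_neg (by omega), neg_zero]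

/-! ### The Killing fields after the elimination -/

/-- On the eliminated variables the Killing field `Z_{N+s-p}` of dimension `N + s` agrees in its
first `N` components with the Killing field `Z_{n-p}` of dimension `n`. -/
lemma killing_assemble_viete {n N s p j : ℕ} (hsn : s ≤ n) (hp : p < s) (hj : 1 ≤ j) (hjN : j ≤ N)
    {ι : Type} [Fintype ι] [DecidableEq ι] {U : Set (ι → ℝ)} (hU : IsOpen U)
    {lam : Fin n → (ι → ℝ) → ℝ} (x : ι) {f : ℕ → (ι → ℝ) → ℝ}
    (hf : ∀ b ∈ Finset.Icc 1 s, Set.EqOn (f b) (fun t => viete (fun r => lam r t) (n + 1 - b)) U)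
    {t : ι → ℝ} (ht : t ∈ U) :
    killing x (N + s) (N + s - p) j (assemble N s (fun j t => viete (fun r => lam r t) j) f) t
      = ∑ m ∈ Finset.range j,
        (viete (fun r => lam r t) m
            * pderiv x (fun t => viete (fun r => lam r t) (j + (n - p) - 1 - m)) t
          - viete (fun r => lam r t) (j + (n - p) - 1 - m)
            * pderiv x (fun t => viete (fun r => lam r t) m) t) := by
  have hlow : ∀ α ≤ N, (fun t' => coord (N + s)
      (fun l => assemble N s (fun j t => viete (fun r => lam r t) j) f l t') α)
        = fun t => viete (fun r => lam r t) α := by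
    intro α hα
    funext t'
    rw [coord, assemble_of_le hα, if_pos (show α ≤ N + s by omega)]
    split_ifs with h
    · rw [h, viete_zero]
    · rfl
  have hhigh : ∀ α, N < α → Set.EqOn (fun t' => coord (N + s)
      (fun l => assemble N s (fun j t => viete (fun r => lam r t) j) f l t') α)
        (fun t => viete (fun r => lam r t) (α + n - (N + s))) U := by
    intro α hα t' ht'
    simp only
    rcases le_or_gt α (N + s) with h | h
    · rw [coord, if_neg (by omega), if_pos h, assemble_of_gt hα,
        hf _ (Finset.mem_Icc.mpr (by omega)) ht',
        show n + 1 - (N + s + 1 - α) = α + n - (N + s) by omega]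
    · rw [coord_of_lt h, viete_of_lt _ (by omega)]
  have hIcc : Finset.Icc 1 (j - 1) = Finset.Ico 1 j := by ext; simp; omega
  simp only [killing]
  rw [Finset.range_eq_Ico, Finset.sum_eq_sum_Ico_succ_bot (by omega), hIcc]
  congr 1
  · have hz : pderiv x (fun t => viete (fun r => lam r t) 0) t = 0 := by
      simp [pderiv, viete_zero]
    rw [pderiv_congr hU (hhigh _ (by omega)) ht, hz, viete_zero, one_mul, mul_zero, sub_zero,
      show j + (N + s - p) - 1 + n - (N + s) = j + (n - p) - 1 - 0 by omega]
  · refine Finset.sum_congr rfl fun k hk => ?_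
    rw [Finset.mem_Ico] at hk
    have h1 := hlow k (by omega)
    have h2 := hhigh (j + (N + s - p) - k - 1) (by omega)
    rw [h1, pderiv_congr hU h2 ht]
    have h3 := h2 ht
    have h4 := congrFun h1 t
    simp only at h3 h4
    rw [h3, h4, show j + (N + s - p) - k - 1 + n - (N + s) = j + (n - p) - 1 - k by omega]

/-- A continuous function without zeros on a preconnected set has a constant sign. -/
lemma exists_sign_of_isPreconnected {X : Type*} [TopologicalSpace X] {U : Set X}
    (hU : IsPreconnected U) {g : X → ℝ} (hg : ContinuousOn g U) (h0 : ∀ t ∈ U, g t ≠ 0) :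
    ∃ η : ℝ, (η = 1 ∨ η = -1) ∧ ∀ t ∈ U, 0 < η * g t := by
  by_cases h : ∃ t ∈ U, g t < 0
  · obtain ⟨t, ht, hgt⟩ := h
    refine ⟨-1, Or.inr rfl, fun t' ht' => ?_⟩
    by_contra hcon
    obtain ⟨z, hz, hgz⟩ := hU.intermediate_value ht ht' hg
      (show (0 : ℝ) ∈ Set.Icc (g t) (g t') from ⟨hgt.le, by linarith⟩)
    exact h0 z hz hgz
  · push Not at h
    exact ⟨1, Or.inl rfl, fun t ht => by rw [one_mul]; exact (h t ht).lt_of_ne' (h0 t ht)⟩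

end HarryDym

end

theorem mainTheorem2 (n N β : ℕ) (hN : 1 ≤ N) (hβ : β < n) (a c : Fin n → ℝ)
    (U : Set (Fin n → ℝ)) (hU : IsOpen U) (hUc : IsPreconnected U)
    (lam : Fin n → (Fin n → ℝ) → ℝ)
    (hlam : HarryDym.IsImplicitSolution n N β a c U lam) :
    ∃ η : ℝ, (η = 1 ∨ η = -1) ∧
      HarryDym.SolvesFirstFlows (⟨0, by omega⟩ : Fin n) N (HarryDym.flowCount n β)
        (fun p => (⟨n - 1 - p, by omega⟩ : Fin n)) η U
        (fun j t => HarryDym.viete (fun r => lam r t) j) := by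
  have hs : HarryDym.flowCount n β ≤ n - β := by
    rw [HarryDym.flowCount]; split_ifs <;> omega
  have hl := fun r => HarryDym.contDiffOn_lam hU hlam r
  have hu := HarryDym.contDiffOn_viete hl
  obtain ⟨σ, hσ, hdyn⟩ := HarryDym.exists_pderiv_lam hU hlam
  obtain ⟨-, hinj, -, J, -, -, -, hJ, -, hmem, -⟩ := hlam
  have hne : ∀ t ∈ U, ∀ r, lam r t ≠ 0 := fun t ht r => (hJ r _ (hmem r t ht)).1
  have hpos : ∀ t ∈ U, ∀ r, 0 < HarryDym.radicand n N β a (lam r t) := fun t ht r =>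
    (hJ r _ (hmem r t ht)).2
  have hone : ∀ t r, HarryDym.horner (fun s => lam s t) r (0 + 1) = 1 := fun t r => by
    simp [HarryDym.horner, HarryDym.viete_zero]
  have hdub : ∀ t ∈ U, ∀ r, ((HarryDym.cofactor (fun s => lam s t) r).eval (lam r t)
      * HarryDym.pderiv (⟨0, by omega⟩ : Fin n) (lam r) t) ^ 2
        = 4 * HarryDym.radicand n N β a (lam r t) := fun t ht r => by
    rw [hdyn t ht r, hone, mul_one, mul_pow, mul_pow, hσ, Real.sq_sqrt (hpos t ht r).le]
    norm_num
  -- The branch is the sign of the eliminated variable `q_{N+s} = q_n = (-1)^n ∏ λ_r`.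
  obtain ⟨η, hη, hsign⟩ := HarryDym.exists_sign_of_isPreconnected hUc (hu n).continuousOn
    fun t ht => by
      rw [HarryDym.viete_self]
      exact mul_ne_zero (pow_ne_zero _ (by norm_num))
        (Finset.prod_ne_zero_iff.mpr fun r _ => hne t ht r)
  have helim := HarryDym.isElimination_viete hN hβ hs a hU ⟨hl, hinj, hne, hpos, hdub⟩ hsign
  refine ⟨η, hη, fun j _ => hu j, ⟨_, helim⟩, fun f hf p j hj t ht => ?_⟩
  rw [Finset.mem_Icc] at hj
  have hp := p.isLt
  rw [HarryDym.killing_assemble_viete (by omega) hp hj.1 hj.2 hU _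
    (HarryDym.elimination_unique hN hU (fun j _ => hu j) hf helim) ht]
  refine HarryDym.pderiv_viete_eq_sum
    (fun r => HarryDym.differentiableAt_of_contDiffOn hU (hl r) ht) (fun r => ?_) j
  refine mul_left_cancel₀ (HarryDym.eval_cofactor_ne_zero (hinj t ht) r) ?_
  have h0 := hdyn t ht r (⟨0, by omega⟩ : Fin n)
  rw [hone, mul_one] at h0
  rw [hdyn t ht r, mul_left_comm, h0, show n - 1 - (p : ℕ) + 1 = n - p by omega]
  ring
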